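/- Let $L$ be a countable first-order language, all of whose relation symbols have positive arity, with a computable representation: the relation symbols and the function symbols (constants are $0$-ary function symbols) are named by the elements of two disjoint computable subsets of $\omega$, and the arity is computable from the name. For an oracle $s$, an $L$-structure is $s$-computable if its underlying set is an $s$-computable subset of $\omega$ and the set of true instances of relations, the set of false instances of relations and the graphs of the functions are $s$-c.e., uniformly in the names of the symbols. (Structures may be empty.) An age is a class $\mathcal K$ of finitely generated $L$-structures closed under isomorphism. A computable age representing $\mathcal K$ is a uniformly computable sequence $\mathbb K=(\mathbf a_i,\mathcal A_i)_{i\in\omega}$, where $\mathcal A_i\in\mathcal K$ is a computable structure generated by the finite tuple $\mathbf a_i$, such that every structure in $\mathcal K$ is isomorphic to some $\mathcal A_i$. Let $\mathrm{EmbedInfo}(\mathbb K)$ be the set of all $(i,\mathbf b,j,\mathbf c)$ such that $\mathbf b$ and $\mathbf c$ are finite tuples of equal length in $\mathcal A_i$ and $\mathcal A_j$, respectively, that satisfy the same atomic formulas. A structure $\mathcal M$ is an $s$-computable Fraïssé limit of $\mathbb K$ if $\mathcal M$ is an $s$-computable structure, the class of all structures isomorphic to a finitely generated substructure of $\mathcal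 M$ is $\mathcal K$, every isomorphism between finitely generated substructures of $\mathcal M$ extends to an automorphism of $\mathcal M$, and this holds $s$-computably: there is an $s$-computable function taking each pair $(\mathbf a,\mathbf b)$ of finite tuples of equal length from $\mathcal M$ to an $s$-index of a bijection of $\mathcal M$ with itself which, whenever $\mathbf a$ and $\mathbf b$ satisfy the same atomic formulas, is an automorphism of $\mathcal M$ taking $\mathbf a$ to $\mathbf b$. **Theorem.** Suppose that $\mathbb K$ is a computable age representing $\mathcal K$, and that $\mathcal K$ has the hereditary property (for finitely generated substructures), the joint embedding property and the amalgamation property. Then $\mathrm{EmbedInfo}(\mathbb K)\le_{\mathrm T}\mathbf 0'$, and there is a structure $\mathcal M$ that is an $\mathrm{EmbedInfo}(\mathbb K)$-computable Fraïssé limit of $\mathbb K$ and hence also a $\mathbf 0'$-computable Fraïssé limit of $\mathbb K$. -/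

import Mathlib

open FirstOrder FirstOrder.Language CategoryTheory
open scoped Computability

universe u v

/-! ### Relative computability -/

open Classical in
/-- The characteristic function of a set of (coded) finite objects, used as an oracle. -/
noncomputable def charFun {α : Type} [Encodable α] (A : Set α) : ℕ →. ℕ :=
  fun n => Part.some (if ∃ a ∈ A, Encodable.encode a = n then 1 else 0)

/-- `p` is computably enumerable relative to the oracle `s`. -/
def CEIn {α : Type} [Primcodable α] (s : ℕ →. ℕ) (p : α → Prop) : Prop :=
  RecursiveIn {s} fun a => Part.assert (p a) fun _ => Part.some ()

/-- `p` is decidable relative to the oracle `s`. -/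
def DecidableIn {α : Type} [Primcodable α] (s : ℕ →. ℕ) (p : α → Prop) : Prop :=
  ∃ _ : DecidablePred p, ComputableIn {s} fun a => decide (p a)

/-- The halting problem; its Turing degree is `0'`. -/
def haltingSet : Set (Nat.Partrec.Code × ℕ) :=
  {p | (p.1.eval p.2).Dom}

/-- Programs for functions `ℕ →. ℕ` that may query an oracle. -/
inductive OracleCode : Type
  | zero : OracleCode
  | succ : OracleCode
  | left : OracleCode
  | right : OracleCode
  | oracle : OracleCode
  | pair : OracleCode → OracleCode → OracleCode
  | comp : OracleCode → OracleCode → OracleCode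
  | prec : OracleCode → OracleCode → OracleCode
  | rfind : OracleCode → OracleCode

namespace OracleCode

/-- The partial function computed by a program with oracle `s`. -/
def eval (s : ℕ →. ℕ) : OracleCode → ℕ →. ℕ
  | zero => fun _ => Part.some 0
  | succ => fun n => Part.some (n + 1)
  | left => fun n => Part.some (Nat.unpair n).1
  | right => fun n => Part.some (Nat.unpair n).2
  | oracle => s
  | pair c d => fun n => Nat.pair <$> eval s c n <*> eval s d n
  | comp c d => fun n => eval s d n >>= eval s c
  | prec c d => fun p =>
      (Nat.unpair p).2.rec (eval s c (Nat.unpair p).1) fun y IH => do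
        let i ← IH
        eval s d (Nat.pair (Nat.unpair p).1 (Nat.pair y i))
  | rfind c => fun a => Nat.rfind fun n => (fun m => m = 0) <$> eval s c (Nat.pair a n)

/-- The index (Gödel number) of a program. -/
def index : OracleCode → ℕ
  | zero => 0
  | succ => 1
  | left => 2
  | right => 3
  | oracle => 4
  | pair c d => 4 * Nat.pair (index c) (index d) + 5
  | comp c d => 4 * Nat.pair (index c) (index d) + 6
  | prec c d => 4 * Nat.pair (index c) (index d) + 7
  | rfind c => 4 * index c + 8

/-- Distinct programs have distinct indices. -/
theorem index_injective : Function.Injective index := by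
  intro c
  induction c with
  | zero | succ | left | right | oracle =>
    intro d h
    cases d <;> simp only [index] at h <;> first | rfl | omega
  | pair a b iha ihb | comp a b iha ihb | prec a b iha ihb =>
    intro d h
    cases d <;> simp only [index] at h <;> try omega
    rename_i a' b'
    have h' : Nat.pair (index a) (index b) = Nat.pair (index a') (index b') := by omega
    rw [Nat.pair_eq_pair] at h'
    rw [iha h'.1, ihb h'.2]
  | rfind a iha =>
    intro d h
    cases d <;> simp only [index] at h <;> try omega
    rename_i a'
    rw [iha (by omega : index a = index a')]

/-- The functions with an `s`-program are exactly the functions recursive in `s`. -/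
theorem exists_eval_iff (s f : ℕ →. ℕ) : (∃ c, eval s c = f) ↔ Nat.RecursiveIn {s} f := by
  constructor
  · rintro ⟨c, rfl⟩
    induction c with
    | zero => exact .zero
    | succ => exact .succ
    | left => exact .left
    | right => exact .right
    | oracle => exact .oracle _ rfl
    | pair _ _ h₁ h₂ => exact .pair h₁ h₂
    | comp _ _ h₁ h₂ => exact .comp h₁ h₂
    | prec _ _ h₁ h₂ => exact .prec h₁ h₂
    | rfind _ h => exact .rfind h
  · intro h
    induction h with
    | zero => exact ⟨zero, rfl⟩
    | succ => exact ⟨succ, rfl⟩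
    | left => exact ⟨left, rfl⟩
    | right => exact ⟨right, rfl⟩
    | oracle g hg => exact ⟨oracle, hg.symm⟩
    | pair _ _ h₁ h₂ => obtain ⟨c, rfl⟩ := h₁; obtain ⟨d, rfl⟩ := h₂; exact ⟨pair c d, rfl⟩
    | comp _ _ h₁ h₂ => obtain ⟨c, rfl⟩ := h₁; obtain ⟨d, rfl⟩ := h₂; exact ⟨comp c d, rfl⟩
    | prec _ _ h₁ h₂ => obtain ⟨c, rfl⟩ := h₁; obtain ⟨d, rfl⟩ := h₂; exact ⟨prec c d, rfl⟩
    | rfind _ h => obtain ⟨c, rfl⟩ := h; exact ⟨rfind c, rfl⟩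

end OracleCode

/-! ### Computable languages and structures on sets of natural numbers -/

/-- A computable representation of a language all of whose relation symbols have positive arity:
the symbols are named by the elements of two disjoint computable sets of natural numbers,
and the arity of a symbol is computable from its name. -/
structure ComputableLanguage (L : FirstOrder.Language.{u, v}) where
  relNames : Set ℕ
  funNames : Set ℕ
  relNames_computable : ComputablePred fun n => n ∈ relNames
  funNames_computable : ComputablePred fun n => n ∈ funNames
  disjoint : Disjoint relNames funNames
  rel : relNames ≃ (Σ k, L.Relations k)
  func : funNames ≃ (Σ k, L.Functions k)
  arity_computable : ∃ ar : ℕ → ℕ, Computable ar ∧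
    (∀ n : relNames, ar n = (rel n).1) ∧ (∀ n : funNames, ar n = (func n).1)
  rel_arity_pos : ∀ n : relNames, 0 < (rel n).1

/-- An `L`-structure whose underlying set is a set of natural numbers. -/
structure NatStructure (L : FirstOrder.Language.{u, v}) where
  dom : Set ℕ
  str : L.Structure dom

namespace NatStructure

variable {L : FirstOrder.Language.{u, v}}

instance instStructureDom (M : NatStructure L) : L.Structure M.dom := M.str

/-- The pairs `(n, a)` such that `n` names a relation symbol that holds of the tuple `a`. -/
def posDiagram (ρ : ComputableLanguage L) (M : NatStructure L) : Set (ℕ × List ℕ) :=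
  {p | ∃ (h : p.1 ∈ ρ.relNames) (a : Fin (ρ.rel ⟨p.1, h⟩).1 → M.dom),
    p.2 = List.ofFn (fun k => (a k : ℕ)) ∧ Structure.RelMap (ρ.rel ⟨p.1, h⟩).2 a}

/-- The pairs `(n, a)` such that `n` names a relation symbol that fails of the tuple `a`. -/
def negDiagram (ρ : ComputableLanguage L) (M : NatStructure L) : Set (ℕ × List ℕ) :=
  {p | ∃ (h : p.1 ∈ ρ.relNames) (a : Fin (ρ.rel ⟨p.1, h⟩).1 → M.dom),
    p.2 = List.ofFn (fun k => (a k : ℕ)) ∧ ¬ Structure.RelMap (ρ.rel ⟨p.1, h⟩).2 a}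

/-- The triples `(n, a, b)` such that `n` names a function symbol whose value at `a` is `b`. -/
def funGraph (ρ : ComputableLanguage L) (M : NatStructure L) : Set (ℕ × List ℕ × ℕ) :=
  {p | ∃ (h : p.1 ∈ ρ.funNames) (a : Fin (ρ.func ⟨p.1, h⟩).1 → M.dom),
    p.2.1 = List.ofFn (fun k => (a k : ℕ)) ∧
      ((Structure.funMap (ρ.func ⟨p.1, h⟩).2 a : M.dom) : ℕ) = p.2.2}

/-- `M` is an `s`-computable structure. -/
structure IsComputableIn (ρ : ComputableLanguage L) (s : ℕ →. ℕ) (M : NatStructure L) :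
    Prop where
  dom_decidable : DecidableIn s fun x => x ∈ M.dom
  pos_ce : CEIn s fun p => p ∈ M.posDiagram ρ
  neg_ce : CEIn s fun p => p ∈ M.negDiagram ρ
  fun_ce : CEIn s fun p => p ∈ M.funGraph ρ

end NatStructure

/-- Two tuples of the same length satisfy the same atomic formulas. -/
def SameAtomicType {L : FirstOrder.Language.{u, v}} {A B : Type} [L.Structure A] [L.Structure B] {n : ℕ}
    (a : Fin n → A) (b : Fin n → B) : Prop :=
  ∀ φ : L.Formula (Fin n), BoundedFormula.IsAtomic φ → (φ.Realize a ↔ φ.Realize b)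

/-! ### Ages -/

/-- An age: a class of finitely generated structures closed under isomorphism. -/
structure IsAge {L : FirstOrder.Language.{u, v}} (K : Set (Bundled.{0} L.Structure)) : Prop where
  fg : ∀ A ∈ K, Structure.FG L A
  iso_closed : ∀ A B : Bundled.{0} L.Structure, A ∈ K → Nonempty (A ≃[L] B) → B ∈ K

/-- A computable representation of the age `K`: a uniformly computable sequence of computable
structures, each with a generating tuple, that belong to `K` and represent every isomorphism
type in `K`. -/
structure ComputableAge {L : FirstOrder.Language.{u, v}} (ρ : ComputableLanguage L)
    (K : Set (Bundled.{0} L.Structure)) where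
  tuple : ℕ → List ℕ
  struct : ℕ → NatStructure L
  tuple_computable : Computable tuple
  dom_computable : ComputablePred fun p : ℕ × ℕ => p.2 ∈ (struct p.1).dom
  pos_ce : REPred fun p : ℕ × (ℕ × List ℕ) => p.2 ∈ (struct p.1).posDiagram ρ
  neg_ce : REPred fun p : ℕ × (ℕ × List ℕ) => p.2 ∈ (struct p.1).negDiagram ρ
  fun_ce : REPred fun p : ℕ × (ℕ × List ℕ × ℕ) => p.2 ∈ (struct p.1).funGraph ρ
  tuple_mem : ∀ i, ∀ x ∈ tuple i, x ∈ (struct i).dom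
  generates : ∀ i, Substructure.closure L {x : (struct i).dom | (x : ℕ) ∈ tuple i} = ⊤
  mem_age : ∀ i, (⟨(struct i).dom, (struct i).str⟩ : Bundled.{0} L.Structure) ∈ K
  exhausts : ∀ A ∈ K, ∃ i, Nonempty (A ≃[L] (struct i).dom)

/-- The embedding information: all `((i, a), (j, b))` such that `a` is a tuple in the `i`-th
structure, `b` is a tuple in the `j`-th structure and `a`, `b` satisfy the same atomic formulas
(equivalently, `a ↦ b` extends to an isomorphism of the generated substructures). -/
def ComputableAge.embedInfo {L : FirstOrder.Language.{u, v}} {ρ : ComputableLanguage L}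
    {K : Set (Bundled.{0} L.Structure)} (𝕂 : ComputableAge ρ K) :
    Set ((ℕ × List ℕ) × (ℕ × List ℕ)) :=
  {p | ∃ (n : ℕ) (a : Fin n → (𝕂.struct p.1.1).dom) (b : Fin n → (𝕂.struct p.2.1).dom),
    p.1.2 = List.ofFn (fun k => (a k : ℕ)) ∧ p.2.2 = List.ofFn (fun k => (b k : ℕ)) ∧
      SameAtomicType (L := L) a b}

/-! ### Computable Fraïssé limits -/

/-- `e` is an `s`-index of the bijection `σ` of the underlying set of `M`: the partial function
with `s`-index `e` has exactly the graph of `σ`. -/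
def IsIndexOf {L : FirstOrder.Language.{u, v}} {M : NatStructure L} (s : ℕ →. ℕ) (e : ℕ)
    (σ : Equiv.Perm M.dom) : Prop :=
  ∃ c : OracleCode, c.index = e ∧
    ∀ x y : ℕ, y ∈ c.eval s x ↔ ∃ h : x ∈ M.dom, (σ ⟨x, h⟩ : ℕ) = y

/-- `M` is `s`-computably ultrahomogeneous: an `s`-computable function `g` takes each pair of
tuples of equal length to an `s`-index of a bijection of `M` which, if the tuples satisfy the same
atomic formulas, is an automorphism taking the first tuple to the second. -/
def IsComputablyUltrahomogeneousIn {L : FirstOrder.Language.{u, v}} (s : ℕ →. ℕ) (M : NatStructure L) :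
    Prop :=
  ∃ g : List ℕ × List ℕ →. ℕ, RecursiveIn {s} g ∧
    ∀ (n : ℕ) (a b : Fin n → M.dom), ∃ (e : ℕ) (σ : Equiv.Perm M.dom),
      e ∈ g (List.ofFn (fun k => (a k : ℕ)), List.ofFn (fun k => (b k : ℕ))) ∧
      IsIndexOf s e σ ∧
      (SameAtomicType (L := L) a b →
        (∃ α : M.dom ≃[L] M.dom, ∀ x, α x = σ x) ∧ ∀ k, σ (a k) = b k)

/-- `M` is an `s`-computable Fraïssé limit of the age `K`: an `s`-computable structure that is a
Fraïssé limit of `K` and is `s`-computably ultrahomogeneous. -/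
structure IsFraisseLimitComputableIn {L : FirstOrder.Language.{u, v}} (ρ : ComputableLanguage L)
    (K : Set (Bundled.{0} L.Structure)) (s : ℕ →. ℕ) (M : NatStructure L) : Prop where
  computable : M.IsComputableIn ρ s
  age_eq : L.age M.dom = K
  ultrahomogeneous : L.IsUltrahomogeneous M.dom
  computably_ultrahomogeneous : IsComputablyUltrahomogeneousIn s M

/-! ### Closure properties of oracle computability -/

/-! Two tuples fail to satisfy the same atomic formulas exactly when some terms separate them: an
equation between terms holds for one tuple only, or a relation holds of terms at one tuple and fails
at the other. The function graphs are c.e., so the pairs of values of a common term at the two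
tuples can be enumerated (`gen`); the positive and negative diagrams are c.e. too, so every
separation is found eventually. Hence the complement of the embedding information is c.e.
(`rePred_notMem_embedInfo`) and one halting question decides membership.

The limit is a direct limit of finite words rather than of structures. A stage is a word of length
`n + 1` in some structure of the age. The next word has the old atomic type on its first `n + 1`
entries, and its last entry realizes one prescribed one-point extension: if the entries at given
positions look like a tuple `c` of some listed structure, the new entry is to these as `c'` is to
`c`. The hereditary and amalgamation properties provide such a word (`exists_extends`), and the
embedding information recognizes it, so that an unbounded search finds it. Every task recurs
infinitely often (`exists_richSequence`).

The elements of the limit are the positions at which an element occurs for the first time, and the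
atomic type of a finite tuple is read off at any stage that has all its positions (`sameType_val`).
Closure under the functions is itself a case of richness: the value of a function at a stage is a
one-point extension of its arguments (`exists_funMap_eq`). Richness gives one-point extensions
inside the limit (`exists_sim_limit_cons`); together with joint embedding, which handles the empty
tuple, it gives the age. Similarity in the limit is decidable from the oracle, so back-and-forth is
effective, and the `s-m-n` theorem turns it into an index computable from the two tuples.

The structure is built from the embedding information alone and its properties pass to stronger
oracles, so one structure serves both oracles. If all structures of the age are empty, there is no
word to start from and any listed structure is the limit. -/

namespace RecursiveIn

variable {α β γ σ : Type*} [Primcodable α] [Primcodable β] [Primcodable γ] [Primcodable σ]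
variable {O : Set (ℕ →. ℕ)}

theorem comp {f : β →. σ} {g : α → β} (hf : RecursiveIn O f) (hg : ComputableIn O g) :
    RecursiveIn O fun a => f (g a) :=
  (Nat.RecursiveIn.comp hf hg).of_eq fun n => by
    simp only [Part.map_some, Part.bind_eq_bind]
    rcases e : Encodable.decode (α := α) n with - | a <;> simp [Encodable.encodek]

theorem bind {f : α →. β} {g : α × β →. σ} (hf : RecursiveIn O f) (hg : RecursiveIn O g) :
    RecursiveIn O fun a => (f a).bind fun b => g (a, b) :=
  (Nat.RecursiveIn.comp hg (Nat.RecursiveIn.pair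
    (Nat.Partrec.recursiveIn Nat.Partrec.some) hf)).of_eq fun n => by
    rcases e : Encodable.decode (α := α) n <;> simp [Seq.seq, e, Encodable.encodek]

theorem map {f : α →. β} {g : α × β → σ} (hf : RecursiveIn O f) (hg : ComputableIn O g) :
    RecursiveIn O fun a => (f a).map fun b => g (a, b) := by
  simpa [Part.bind_some_eq_map] using! RecursiveIn.bind hf hg.recursiveIn

theorem nat_rec {f : α → ℕ} {g : α →. σ} {h : α × (ℕ × σ) →. σ} (hf : ComputableIn O f)
    (hg : RecursiveIn O g) (hh : RecursiveIn O h) :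
    RecursiveIn O fun a => (f a).rec (g a) fun y IH => IH.bind fun i => h (a, y, i) :=
  ((Nat.RecursiveIn.prec hg hh).comp
    (.pair (Nat.Partrec.recursiveIn Nat.Partrec.some) hf)).of_eq fun n => by
    rcases e : Encodable.decode (α := α) n with - | a
    · simp [Seq.seq]
    · simp only [Seq.seq, e, Part.coe_some, Part.bind_some, Part.map_some, Part.map_eq_map,
        Part.bind_eq_bind, Nat.unpair_pair]
      induction f a <;> simp_all

theorem rfind {p : α × ℕ →. Bool} (hp : RecursiveIn O p) :
    RecursiveIn O fun a => Nat.rfind fun n => p (a, n) :=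
  -- Search on numbers looks for a zero, so `true` is coded by 0 and `false` by 1.
  (Nat.RecursiveIn.rfind (hp.map
    ((Primrec.dom_bool fun b => cond b 0 1).comp Primrec.snd).computableIn)).of_eq fun n => by
    rcases e : Encodable.decode (α := α) n with - | a
    · simpa [e] using Nat.rfind_zero_none _ rfl
    · have : ∀ b : Bool, decide ((bif b then 0 else 1) = 0) = b := by decide
      simp [Function.comp_def, e, Part.map_map, Part.map_id', this]

theorem rfindOpt {f : α × ℕ → Option σ} (hf : ComputableIn O f) :
    RecursiveIn O fun a => Nat.rfindOpt fun n => f (a, n) :=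
  (rfind (p := fun q => Part.some (f q).isSome)
    (comp (f := fun o : Option σ => Part.some o.isSome)
      Primrec.option_isSome.computableIn hf)).bind
    (comp (f := fun o : Option σ => (o : Part σ)) (Computable.ofOption Computable.id).recursiveIn hf)

end RecursiveIn

namespace ComputableIn

variable {α β γ σ : Type*} [Primcodable α] [Primcodable β] [Primcodable γ] [Primcodable σ]
variable {O : Set (ℕ →. ℕ)}

theorem comp {f : β → σ} {g : α → β} (hf : ComputableIn O f) (hg : ComputableIn O g) :
    ComputableIn O fun a => f (g a) :=
  RecursiveIn.comp (f := fun b => Part.some (f b)) hf hg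

theorem pair {f : α → β} {g : α → γ} (hf : ComputableIn O f) (hg : ComputableIn O g) :
    ComputableIn O fun a => (f a, g a) :=
  (Nat.RecursiveIn.pair hf hg).of_eq fun n => by
    rcases e : Encodable.decode (α := α) n <;> simp [Seq.seq]

theorem of_eq {f g : α → σ} (hf : ComputableIn O f) (H : ∀ a, f a = g a) : ComputableIn O g :=
  (funext H : f = g) ▸ hf

theorem nat_rec {f : α → ℕ} {g : α → σ} {h : α × (ℕ × σ) → σ} (hf : ComputableIn O f)
    (hg : ComputableIn O g) (hh : ComputableIn O h) :
    ComputableIn O fun a => Nat.rec (motive := fun _ => σ) (g a) (fun y IH => h (a, y, IH)) (f a) :=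
  (RecursiveIn.nat_rec hf hg.recursiveIn hh.recursiveIn).of_eq fun a => by
    beta_reduce
    generalize f a = n
    induction n <;> simp_all

theorem cond {c : α → Bool} {f g : α → σ} (hc : ComputableIn O c) (hf : ComputableIn O f)
    (hg : ComputableIn O g) : ComputableIn O fun a => bif c a then f a else g a :=
  (nat_rec (h := fun q => f q.1) (Primrec.encode.computableIn.comp hc) hg
    (hf.comp ComputableIn.fst)).of_eq fun a => by cases c a <;> rfl

end ComputableIn

/-! ### Decidable and computably enumerable predicates relative to an oracle -/

theorem RecursiveIn.trans_turingReducible {α σ : Type*} [Primcodable α] [Primcodable σ]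
    {s t : ℕ →. ℕ} {f : α →. σ} (hf : RecursiveIn {s} f) (h : s ≤ᵀ t) : RecursiveIn {t} f :=
  hf.subst (by simpa using h)

namespace DecidableIn

variable {α β : Type} [Primcodable α] [Primcodable β] {s : ℕ →. ℕ} {p q : α → Prop}

theorem iff_bool : DecidableIn s p ↔ ∃ f : α → Bool, ComputableIn {s} f ∧ ∀ a, f a = true ↔ p a :=
  ⟨fun ⟨inst, h⟩ => ⟨fun a => decide (p a), h, fun a => @decide_eq_true_iff _ (inst a)⟩,
    fun ⟨f, hf, h⟩ => by
      classical
      exact ⟨inferInstance, hf.of_eq fun a => by rw [Bool.eq_iff_iff, h, decide_eq_true_iff]⟩⟩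

theorem of_iff (hp : DecidableIn s p) (h : ∀ a, p a ↔ q a) : DecidableIn s q :=
  (funext fun a => propext (h a) : p = q) ▸ hp

theorem of_computablePred (hp : ComputablePred p) : DecidableIn s p :=
  hp.imp fun _ h => h.computableIn

theorem comp {r : β → Prop} {f : α → β} (hr : DecidableIn s r) (hf : ComputableIn {s} f) :
    DecidableIn s fun a => r (f a) := by
  obtain ⟨g, hg, h⟩ := iff_bool.1 hr
  exact iff_bool.2 ⟨_, hg.comp hf, fun a => h _⟩

theorem and (hp : DecidableIn s p) (hq : DecidableIn s q) : DecidableIn s fun a => p a ∧ q a := by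
  obtain ⟨f, hf, h⟩ := iff_bool.1 hp
  obtain ⟨g, hg, h'⟩ := iff_bool.1 hq
  exact iff_bool.2 ⟨_, Primrec.and.computableIn₂.comp (hf.pair hg), fun a => by simp [h, h']⟩

theorem not (hp : DecidableIn s p) : DecidableIn s fun a => ¬ p a := by
  obtain ⟨f, hf, h⟩ := iff_bool.1 hp
  exact iff_bool.2 ⟨_, Primrec.not.computableIn.comp hf, fun a => by simp [← h]⟩

theorem imp (hp : DecidableIn s p) (hq : DecidableIn s q) : DecidableIn s fun a => p a → q a :=
  (hp.and hq.not).not.of_iff fun a => by tauto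

theorem eq {γ : Type*} [Primcodable γ] {f g : α → γ} (hf : ComputableIn {s} f)
    (hg : ComputableIn {s} g) : DecidableIn s fun a => f a = g a := by
  classical
  have : ComputablePred fun q : γ × γ => q.1 = q.2 := Primrec.eq.computablePred
  obtain ⟨c, hc, h⟩ := ComputablePred.computable_iff.1 this
  refine iff_bool.2 ⟨_, hc.computableIn.comp (hf.pair hg), fun a => ?_⟩
  exact (congrFun h (f a, g a)).symm.to_iff

open Classical in
theorem ite {σ : Type*} [Primcodable σ] {f g : α → σ} (hp : DecidableIn s p)
    (hf : ComputableIn {s} f) (hg : ComputableIn {s} g) :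
    ComputableIn {s} fun a => if p a then f a else g a := by
  obtain ⟨c, hc, h⟩ := iff_bool.1 hp
  refine (hc.cond hf hg).of_eq fun a => ?_
  simp only [← h]
  cases c a <;> rfl

/-- A total relation that is decidable relative to an oracle has a selector computable in it. -/
theorem exists_selector {σ : Type} [Denumerable σ] {r : α × σ → Prop} (hr : DecidableIn s r)
    (h : ∀ a, ∃ b, r (a, b)) : ∃ f : α → σ, ComputableIn {s} f ∧ ∀ a, r (a, f a) := by
  obtain ⟨c, hc, h'⟩ := iff_bool.1 hr
  have hk : ComputableIn {s} fun q : α × ℕ => c (q.1, Denumerable.ofNat σ q.2) :=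
    hc.comp (ComputableIn.fst.pair ((Primrec.ofNat σ).computableIn.comp .snd))
  have hd : ∀ a, ∃ n, n ∈ Nat.rfind fun n => Part.some (c (a, Denumerable.ofNat σ n)) := fun a => by
    obtain ⟨b, hb⟩ := h a
    rw [← Part.dom_iff_mem]
    exact Nat.rfind_dom.2 ⟨Encodable.encode b, by simp [(h' _).2 hb], fun _ => trivial⟩
  choose n hn using hd
  refine ⟨fun a => Denumerable.ofNat σ (n a), (Primrec.ofNat σ).computableIn.comp
    ((RecursiveIn.rfind (p := fun q => Part.some _) hk).of_eq fun a => Part.eq_some_iff.2 (hn a)),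
    fun a => (h' _).1 ?_⟩
  exact (Part.mem_some_iff.1 (Nat.rfind_spec (hn a))).symm

end DecidableIn

namespace CEIn

variable {α β : Type} [Primcodable α] [Primcodable β] {s : ℕ →. ℕ} {p q : α → Prop}

theorem of_iff (hp : CEIn s p) (h : ∀ a, p a ↔ q a) : CEIn s q :=
  (funext fun a => propext (h a) : p = q) ▸ hp

theorem of_rePred (hp : REPred p) : CEIn s p :=
  Partrec.recursiveIn hp

theorem comp {r : β → Prop} {f : α → β} (hr : CEIn s r) (hf : ComputableIn {s} f) :
    CEIn s fun a => r (f a) :=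
  RecursiveIn.comp hr hf

theorem and (hp : CEIn s p) (hq : CEIn s q) : CEIn s fun a => p a ∧ q a :=
  (RecursiveIn.bind hp (g := fun x => Part.assert (q x.1) fun _ => Part.some ())
    (hq.comp ComputableIn.fst)).of_eq fun a => by
    ext; simp [Part.assert]

theorem of_decidableIn (hp : DecidableIn s p) : CEIn s p := by
  obtain ⟨c, hc, h⟩ := DecidableIn.iff_bool.1 hp
  refine (RecursiveIn.comp (f := fun b : Bool => Part.assert (b = true) fun _ => Part.some ())
    (ComputablePred.to_re (p := fun b : Bool => b = true) ?_).recursiveIn hc).of_eq fun a => by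
      rw [propext (h a)]
  exact ComputablePred.computable_iff.2 ⟨_, Computable.id, rfl⟩

end CEIn

/-! ### Families of elements with the same atomic type -/

section SameType

open FirstOrder.Language.Structure FirstOrder.Language.Substructure

variable (L : FirstOrder.Language.{u, v}) {ι κ A B C : Type*}
variable [L.Structure A] [L.Structure B] [L.Structure C]

/-- Two families indexed by the same type satisfy the same atomic formulas. -/
structure SameType (a : ι → A) (b : ι → B) : Prop where
  eq_iff : ∀ t u : L.Term ι, t.realize a = u.realize a ↔ t.realize b = u.realize b
  rel_iff : ∀ {k : ℕ} (R : L.Relations k) (t : Fin k → L.Term ι),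
    RelMap R (fun j => (t j).realize a) ↔ RelMap R (fun j => (t j).realize b)

variable {L}

namespace SameType

variable {a : ι → A} {b : ι → B} {c : ι → C}

theorem symm (h : SameType L a b) : SameType L b a :=
  ⟨fun t u => (h.eq_iff t u).symm, fun R t => (h.rel_iff R t).symm⟩

theorem trans (h : SameType L a b) (h' : SameType L b c) : SameType L a c :=
  ⟨fun t u => (h.eq_iff t u).trans (h'.eq_iff t u),
    fun R t => (h.rel_iff R t).trans (h'.rel_iff R t)⟩

theorem comp (h : SameType L a b) (f : κ → ι) : SameType L (a ∘ f) (b ∘ f) :=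
  ⟨fun t u => by simpa [Term.realize_relabel] using h.eq_iff (t.relabel f) (u.relabel f),
    fun R t => by simpa [Term.realize_relabel] using h.rel_iff R fun j => (t j).relabel f⟩

theorem apply_eq_iff (h : SameType L a b) (i j : ι) : a i = a j ↔ b i = b j :=
  h.eq_iff (.var i) (.var j)

theorem relMap_iff (h : SameType L a b) {k : ℕ} (R : L.Relations k) (v : Fin k → ι) :
    RelMap R (a ∘ v) ↔ RelMap R (b ∘ v) :=
  h.rel_iff R fun j => .var (v j)

theorem funMap_eq_iff (h : SameType L a b) {k : ℕ} (F : L.Functions k) (v : Fin k → ι) (i : ι) :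
    funMap F (a ∘ v) = a i ↔ funMap F (b ∘ v) = b i :=
  h.eq_iff (.func F fun j => .var (v j)) (.var i)

theorem of_embedding (f : A ↪[L] B) (a : ι → A) : SameType L a (f ∘ a) :=
  ⟨fun t u => by simp [HomClass.realize_term], fun R t => by
    simp only [HomClass.realize_term]
    exact (f.map_rel R _).symm⟩

theorem of_jointEmbedding (f : A ↪[L] C) (g : B ↪[L] C) (h : ∀ i, f (a i) = g (b i)) :
    SameType L a b := by
  have : f ∘ a = g ∘ b := funext h
  exact (of_embedding f a).trans (this ▸ (of_embedding g b).symm)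

/-- Each element of the closure is the value at `a` of some term; send it to the value of that term
at `b`. Equality of types makes this independent of the chosen term, injective, and compatible with
functions and relations. -/
theorem exists_embedding (h : SameType L a b) :
    ∃ e : closure L (Set.range a) ↪[L] B, ∀ i, e ⟨a i, subset_closure ⟨i, rfl⟩⟩ = b i := by
  have key : ∀ x : closure L (Set.range a), ∃ t : L.Term ι, t.realize a = x := fun x => by
    obtain ⟨t, ht⟩ := mem_closure_iff_exists_term.1 x.2
    refine ⟨t.relabel fun r => r.2.choose, ?_⟩
    rw [Term.realize_relabel, ← ht]
    congr 1
    exact funext fun r => r.2.choose_spec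
  choose T hT using key
  refine ⟨⟨⟨fun x => (T x).realize b, fun x y hxy => ?_⟩, fun {n} F x => ?_, fun {n} R x => ?_⟩,
    fun i => ?_⟩
  · exact Subtype.ext (by rw [← hT, ← hT, h.eq_iff]; exact hxy)
  · exact (h.eq_iff _ (.func F fun j => T (x j))).1 (by simp only [hT, Term.realize_func]; rfl)
  · refine (h.rel_iff R fun j => T (x j)).symm.trans ?_
    simp only [hT]
    rfl
  · exact (h.eq_iff _ (.var i)).1 (hT _)

end SameType

/-- Atomic formulas are equations and relations between terms; only the empty block `Fin 0` of bound
variables has to be relabelled away. The term version allows arbitrary index types and hence free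
reindexing. -/
theorem sameAtomicType_iff {A B : Type} [L.Structure A] [L.Structure B] {n : ℕ} {a : Fin n → A}
    {b : Fin n → B} : SameAtomicType (L := L) a b ↔ SameType L a b := by
  refine ⟨fun h => ⟨fun t u => ?_, fun R t => ?_⟩, fun h φ hφ => ?_⟩
  · simpa using h (t.equal u) (.equal _ _)
  · simpa using h (R.formula t) (.rel _ _)
  · have key : ∀ {D : Type} [L.Structure D] (d : Fin n → D) (t : L.Term (Fin n ⊕ Fin 0)),
        t.realize (Sum.elim d default) = (t.relabel (Sum.elim id Fin.elim0)).realize d := by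
      intro D _ d t
      rw [Term.realize_relabel]
      congr 1
      ext x
      rcases x with x | x
      · rfl
      · exact x.elim0
    cases hφ with
    | equal t u =>
      simp only [Formula.Realize, BoundedFormula.realize_bdEqual, key]
      exact h.eq_iff _ _
    | rel R t =>
      simp only [Formula.Realize, BoundedFormula.realize_rel, key]
      exact h.rel_iff R _

/-- Amalgamate over the substructure generated by `a`: it is in the class by heredity, and it embeds
into `B` by `a ↦ b`. -/
theorem SameType.amalgamate {K : Set (Bundled.{0} L.Structure)} (hHP : Hereditary K)
    (hAP : Amalgamation K) {A B : Bundled.{0} L.Structure} (hA : A ∈ K) (hB : B ∈ K) [Finite ι]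
    {a : ι → A} {b : ι → B} (h : SameType L a b) :
    ∃ C ∈ K, ∃ (f : A ↪[L] C) (g : B ↪[L] C), ∀ i, f (a i) = g (b i) := by
  obtain ⟨e, he⟩ := h.exists_embedding
  obtain ⟨C, f, g, hC, hfg⟩ := hAP (Bundled.of (closure L (Set.range a))) A B
    (Substructure.subtype _) e (hHP A hA ⟨(fg_iff_structure_fg _).1
      (fg_closure (Set.finite_range a)), ⟨Substructure.subtype _⟩⟩) hA hB
  refine ⟨C, hC, f, g, fun i => ?_⟩
  have := DFunLike.congr_fun hfg ⟨a i, subset_closure ⟨i, rfl⟩⟩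
  rw [← he]
  exact this

end SameType

/-! ### Similar tuples of natural numbers -/

namespace NatStructure

variable {L : FirstOrder.Language.{u, v}} {A B C : NatStructure L} {a b c : List ℕ}

/-- The list `a` of elements of `A` and the list `b` of elements of `B` have the same length and
satisfy the same atomic formulas. -/
def Sim (A B : NatStructure L) (a b : List ℕ) : Prop :=
  ∃ (n : ℕ) (a' : Fin n → A.dom) (b' : Fin n → B.dom),
    a = List.ofFn (fun k => (a' k : ℕ)) ∧ b = List.ofFn (fun k => (b' k : ℕ)) ∧
      SameAtomicType (L := L) a' b'

theorem ofFn_val_injective {n : ℕ} {a a' : Fin n → A.dom}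
    (h : List.ofFn (fun k => (a k : ℕ)) = List.ofFn (fun k => (a' k : ℕ))) : a = a' :=
  funext fun k => Subtype.ext (congrFun (List.ofFn_injective h) k)

theorem sim_ofFn_iff {n : ℕ} {a : Fin n → A.dom} {b : Fin n → B.dom} :
    Sim A B (List.ofFn fun k => (a k : ℕ)) (List.ofFn fun k => (b k : ℕ)) ↔ SameType L a b := by
  refine ⟨?_, fun h => ⟨n, a, b, rfl, rfl, sameAtomicType_iff.2 h⟩⟩
  rintro ⟨m, a', b', ha, hb, h⟩
  obtain rfl : n = m := by simpa using congrArg List.length ha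
  rw [ofFn_val_injective ha, ofFn_val_injective hb]
  exact sameAtomicType_iff.1 h

/-- Indexing by the members of a list of pairs turns sublists, permutations and repetitions into
reindexings, which `SameType.comp` handles. -/
theorem sim_iff_exists_pairs : Sim A B a b ↔ ∃ P : List (A.dom × B.dom),
    a = P.map (fun q => (q.1 : ℕ)) ∧ b = P.map (fun q => (q.2 : ℕ)) ∧
      SameType L (fun q : {q // q ∈ P} => q.1.1) (fun q => q.1.2) := by
  constructor
  · rintro ⟨n, a', b', rfl, rfl, h⟩
    refine ⟨List.ofFn fun k => (a' k, b' k), by simp [List.map_ofFn, Function.comp_def],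
      by simp [List.map_ofFn, Function.comp_def], ?_⟩
    have hk : ∀ q : {q // q ∈ List.ofFn fun k => (a' k, b' k)}, ∃ k, (a' k, b' k) = q.1 :=
      fun q => by simpa [List.mem_ofFn] using q.2
    choose k hk using hk
    convert! (sameAtomicType_iff.1 h).comp k using 2 with q q
    · exact (congrArg Prod.fst (hk q)).symm
    · exact (congrArg Prod.snd (hk q)).symm
  · rintro ⟨P, rfl, rfl, h⟩
    refine ⟨P.length, fun k => P[k].1, fun k => P[k].2, ?_, ?_,
      sameAtomicType_iff.2 (h.comp fun k : Fin P.length => ⟨P[k], List.getElem_mem k.2⟩)⟩ <;>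
    · apply List.ext_getElem <;> simp

theorem Sim.of_sameType {ι : Type*} {f : ι → A.dom} {g : ι → B.dom} (h : SameType L f g)
    (l : List ι) : Sim A B (l.map fun i => (f i : ℕ)) (l.map fun i => (g i : ℕ)) := by
  refine sim_iff_exists_pairs.2 ⟨l.map fun i => (f i, g i), by simp, by simp, ?_⟩
  have hk : ∀ q : {q // q ∈ l.map fun i => (f i, g i)}, ∃ i, (f i, g i) = q.1 := fun q => by
    obtain ⟨i, -, hi⟩ := List.mem_map.1 q.2
    exact ⟨i, hi⟩
  choose k hk using hk
  convert! h.comp k using 2 with q q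
  · exact (congrArg Prod.fst (hk q)).symm
  · exact (congrArg Prod.snd (hk q)).symm

namespace Sim

theorem symm (h : Sim A B a b) : Sim B A b a := by
  obtain ⟨n, a', b', ha, hb, h⟩ := h
  exact ⟨n, b', a', hb, ha, fun φ hφ => (h φ hφ).symm⟩

theorem trans (h : Sim A B a b) (h' : Sim B C b c) : Sim A C a c := by
  obtain ⟨n, a', b', rfl, rfl, h⟩ := h
  obtain ⟨m, b'', c', hb, rfl, h'⟩ := h'
  obtain rfl : n = m := by simpa using congrArg List.length hb
  obtain rfl := ofFn_val_injective hb
  exact ⟨n, a', c', rfl, rfl, fun φ hφ => (h φ hφ).trans (h' φ hφ)⟩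

theorem length_eq (h : Sim A B a b) : a.length = b.length := by
  obtain ⟨n, a', b', rfl, rfl, -⟩ := h
  simp

theorem mem_dom (h : Sim A B a b) {x : ℕ} (hx : x ∈ a) : x ∈ A.dom := by
  obtain ⟨n, a', b', rfl, rfl, -⟩ := h
  obtain ⟨k, rfl⟩ := (List.mem_ofFn' _ _).1 hx
  exact (a' k).2

/-- Self-similarity is the same as having all entries in the domain. In this form the embedding
information also decides whether a stage is legitimate. -/
theorem refl (h : ∀ x ∈ a, x ∈ A.dom) : Sim A A a a := by
  have := Sim.of_sameType (A := A) (B := A)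
    (SameType.of_embedding (L := L) (Embedding.refl L A.dom) id) (a.attach.map fun x => ⟨x.1, h _ x.2⟩)
  simpa [Function.comp_def] using this

theorem tail {x y : ℕ} (h : Sim A B (x :: a) (y :: b)) : Sim A B a b := by
  obtain ⟨P, ha, hb, h⟩ := sim_iff_exists_pairs.1 h
  rcases P with - | ⟨q, P⟩
  · simp at ha
  · simp only [List.map_cons, List.cons.injEq] at ha hb
    exact sim_iff_exists_pairs.2 ⟨P, ha.2, hb.2,
      h.comp fun q : {q // q ∈ P} => ⟨q.1, List.mem_cons_of_mem _ q.2⟩⟩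

end Sim

theorem exists_list_of_forall_mem (h : ∀ x ∈ a, x ∈ A.dom) :
    ∃ l : List A.dom, a = l.map fun x : A.dom => (x : ℕ) :=
  ⟨a.attach.map fun x => ⟨x.1, h _ x.2⟩, by
    rw [List.map_map]; exact a.attach_map_subtype_val.symm⟩

end NatStructure

/-! ### One step of the amalgamation construction -/

/-- The entry of `w` at position `p`, with the first entry as the default value. -/
def pick (w : List ℕ) (p : ℕ) : ℕ := w.getD p w.headI

theorem pick_of_lt {w : List ℕ} {p : ℕ} (h : p < w.length) : pick w p = w[p] := by
  simp [pick, h]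

/-- This is the purpose of the default value: out-of-range positions still give an element of the
structure, so `val` is total. -/
theorem pick_mem {w : List ℕ} (h : w ≠ []) (p : ℕ) : pick w p ∈ w := by
  by_cases hp : p < w.length
  · rw [pick_of_lt hp]; exact List.getElem_mem hp
  · rw [pick, List.getD_eq_default _ _ (not_lt.1 hp)]
    cases w
    · contradiction
    · simp

theorem pick_append_of_lt {w w' : List ℕ} {p : ℕ} (h : p < w.length) :
    pick (w ++ w') p = pick w p := by
  rw [pick_of_lt h, pick_of_lt (by simp; omega), List.getElem_append_left h]

theorem pick_map_of_lt {w : List ℕ} {p : ℕ} (h : p < w.length) (f : ℕ → ℕ) :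
    pick (w.map f) p = f (pick w p) := by
  rw [pick_of_lt h, pick_of_lt (by simpa), List.getElem_map]

namespace ComputableAge

open NatStructure

variable {L : FirstOrder.Language.{u, v}} {ρ : ComputableLanguage L}
  {K : Set (Bundled.{0} L.Structure)} (𝕂 : ComputableAge ρ K)

/-- A finite tuple in the structure with a given index. -/
abbrev Stage := ℕ × List ℕ

/-- An extension task: given positions, a similar tuple in some structure of the age and a further
element of that structure. -/
abbrev Task := List ℕ × (ℕ × (List ℕ × ℕ))

/-- The stage `y` extends the stage `x` by one element, and carries out the task `t` if
that is possible. -/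
def Extends (x : Stage) (t : Task) (y : Stage) : Prop :=
  y.2.length = x.2.length + 1 ∧ Sim (𝕂.struct y.1) (𝕂.struct y.1) y.2 y.2 ∧
    Sim (𝕂.struct x.1) (𝕂.struct y.1) x.2 (y.2.take x.2.length) ∧
    (t.1.sum < x.2.length → Sim (𝕂.struct x.1) (𝕂.struct t.2.1) (t.1.map (pick x.2)) t.2.2.1 →
      t.2.2.2 ∈ (𝕂.struct t.2.1).dom →
      Sim (𝕂.struct t.2.1) (𝕂.struct y.1) (t.2.2.2 :: t.2.2.1)
        (pick y.2 x.2.length :: t.1.map (pick y.2)))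

theorem exists_amalgam (hHP : Hereditary K) (hAP : Amalgamation K) {i j : ℕ} {a b : List ℕ}
    (h : Sim (𝕂.struct i) (𝕂.struct j) a b) :
    ∃ (k : ℕ) (f : (𝕂.struct i).dom ↪[L] (𝕂.struct k).dom)
      (g : (𝕂.struct j).dom ↪[L] (𝕂.struct k).dom) (P : List ((𝕂.struct i).dom × (𝕂.struct j).dom)),
      a = P.map (fun q => (q.1 : ℕ)) ∧ b = P.map (fun q => (q.2 : ℕ)) ∧ ∀ q ∈ P, f q.1 = g q.2 := by
  obtain ⟨P, ha, hb, h⟩ := sim_iff_exists_pairs.1 h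
  obtain ⟨C, hC, f, g, hfg⟩ := h.amalgamate hHP hAP (𝕂.mem_age i) (𝕂.mem_age j)
  obtain ⟨k, ⟨e⟩⟩ := 𝕂.exhausts C hC
  exact ⟨k, e.toEmbedding.comp f, e.toEmbedding.comp g, P, ha, hb,
    fun q hq => congrArg e (hfg ⟨q, hq⟩)⟩

/-- With constants in the language, the empty tuple has a nontrivial atomic type, given by the
closed terms; a joint extension forces these types to agree. -/
theorem sim_nil (hJEP : JointEmbedding K) (i j : ℕ) :
    Sim (𝕂.struct i) (𝕂.struct j) [] [] := by
  obtain ⟨C, -, ⟨f⟩, ⟨g⟩⟩ := hJEP _ (𝕂.mem_age i) _ (𝕂.mem_age j)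
  have h : SameType L (Fin.elim0 : Fin 0 → (𝕂.struct i).dom)
      (Fin.elim0 : Fin 0 → (𝕂.struct j).dom) :=
    .of_jointEmbedding f g fun k => k.elim0
  exact ⟨0, _, _, rfl, rfl, sameAtomicType_iff.2 h⟩

/-- If the task applies, amalgamate the two structures over the matched tuples, move the word into
the amalgam and append the image of `c'`. -/
theorem exists_extends (hHP : Hereditary K) (hAP : Amalgamation K) {x : Stage}
    (hx : ∀ n ∈ x.2, n ∈ (𝕂.struct x.1).dom) (hne : x.2 ≠ []) (t : Task) :
    ∃ y, 𝕂.Extends x t y := by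
  obtain ⟨i, w⟩ := x
  obtain ⟨p, j, c, c'⟩ := t
  dsimp only at hx hne
  -- The sum of the positions serves as a computable bound for each of them.
  by_cases hp : p.sum < w.length ∧ Sim (𝕂.struct i) (𝕂.struct j) (p.map (pick w)) c ∧
      c' ∈ (𝕂.struct j).dom
  · obtain ⟨hp, hs, hc'⟩ := hp
    obtain ⟨k, f, g, P, hP1, hP2, hfg⟩ := 𝕂.exists_amalgam hHP hAP hs
    classical
    let F : ℕ → ℕ := fun n => if h : n ∈ (𝕂.struct i).dom then f ⟨n, h⟩ else 0
    have hF : ∀ n : (𝕂.struct i).dom, F n = f n := fun n => by simp [F]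
    refine ⟨(k, w.map F ++ [(g ⟨c', hc'⟩ : ℕ)]), by simp, Sim.refl ?_, ?_, fun _ _ _ => ?_⟩
    · simp only [List.mem_append, List.mem_map, List.mem_singleton]
      rintro n (⟨m, hm, rfl⟩ | rfl)
      · exact hF ⟨m, hx m hm⟩ ▸ (f _).2
      · exact (g _).2
    · obtain ⟨l, rfl⟩ := exists_list_of_forall_mem hx
      have h1 : (l.map fun x : (𝕂.struct i).dom => (x : ℕ)).map F = l.map fun x => (f x : ℕ) := by
        rw [List.map_map]
        exact List.map_congr_left fun x _ => hF x
      have h2 := Sim.of_sameType (SameType.of_embedding f id) l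
      dsimp only
      rw [h1]
      simpa [List.take_append_of_le_length] using h2
    · have h1 : pick (w.map F ++ [(g ⟨c', hc'⟩ : ℕ)]) w.length = g ⟨c', hc'⟩ := by
        rw [pick_of_lt (by simp)]
        simp
      have h2 : p.map (pick (w.map F ++ [(g ⟨c', hc'⟩ : ℕ)])) = P.map fun q => (g q.2 : ℕ) := by
        have : p.map (pick (w.map F ++ [(g ⟨c', hc'⟩ : ℕ)])) = (p.map (pick w)).map F := by
          rw [List.map_map]
          refine List.map_congr_left fun n hn => ?_
          have hn : n < w.length := (List.le_sum_of_mem hn).trans_lt hp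
          rw [pick_append_of_lt (by simpa), pick_map_of_lt hn, Function.comp]
        rw [this, hP1, List.map_map]
        exact List.map_congr_left fun q hq => by simp [hF, hfg q hq]
      dsimp only
      rw [h1, h2, hP2]
      have := Sim.of_sameType (SameType.of_embedding g id) (⟨c', hc'⟩ :: P.map Prod.snd)
      simpa [Function.comp_def] using this
  · have hh : w.headI ∈ w := by
      cases w
      · contradiction
      · simp
    -- A void task still has to lengthen the word by one, so its first entry is repeated.
    refine ⟨(i, w ++ [w.headI]), by simp, Sim.refl ?_, ?_,
      fun h1 h2 h3 => (hp ⟨h1, h2, h3⟩).elim⟩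
    · rintro n hn
      rcases List.mem_append.1 hn with h | h
      · exact hx n h
      · rw [List.mem_singleton.1 h]; exact hx _ hh
    · simpa using Sim.refl hx

/-- An embedding of the structures of an age into a coherent sequence of tuples that realizes
all one-point extensions. -/
structure RichSequence where
  index : ℕ → ℕ
  word : ℕ → List ℕ
  length_word : ∀ n, (word n).length = n + 1
  mem_dom : ∀ n, ∀ x ∈ word n, x ∈ (𝕂.struct (index n)).dom
  sim_succ : ∀ n, Sim (𝕂.struct (index n)) (𝕂.struct (index (n + 1))) (word n)
    ((word (n + 1)).take (n + 1))
  rich : ∀ (n : ℕ) (p : List ℕ) (j : ℕ) (c : List ℕ) (c' : ℕ), c' ∈ (𝕂.struct j).dom →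
    (∀ m ≥ n, Sim (𝕂.struct (index m)) (𝕂.struct j) (p.map (pick (word m))) c) →
    ∃ m ≥ n, Sim (𝕂.struct j) (𝕂.struct (index (m + 1))) (c' :: c)
      (pick (word (m + 1)) (m + 1) :: p.map (pick (word (m + 1))))

/-- Step `m` carries out the task coded by the first component of `m`, so each task comes up at
arbitrarily late steps. The explicit recursion is kept in the conclusion because the computability
of the sequence is derived from it. -/
theorem exists_richSequence (hne : ∃ i, (𝕂.struct i).dom.Nonempty) {f : Stage × Task → Stage}
    (hf : ∀ x t, Sim (𝕂.struct x.1) (𝕂.struct x.1) x.2 x.2 → x.2 ≠ [] → 𝕂.Extends x t (f (x, t))) :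
    ∃ (x : Stage) (R : 𝕂.RichSequence), ∀ n, (R.index n, R.word n) =
      Nat.rec (motive := fun _ => Stage) x
        (fun m y => f (y, Denumerable.ofNat Task m.unpair.1)) n := by
  obtain ⟨i, a, ha⟩ := hne
  let S : ℕ → Stage := fun n => Nat.rec (motive := fun _ => Stage) (i, [a])
    (fun m y => f (y, Denumerable.ofNat Task m.unpair.1)) n
  have hS : ∀ n, S (n + 1) = f (S n, Denumerable.ofNat Task n.unpair.1) := fun n => rfl
  have inv : ∀ n, (∀ y ∈ (S n).2, y ∈ (𝕂.struct (S n).1).dom) ∧ (S n).2.length = n + 1 ∧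
      𝕂.Extends (S n) (Denumerable.ofNat Task n.unpair.1) (S (n + 1)) := by
    have step : ∀ n, (∀ y ∈ (S n).2, y ∈ (𝕂.struct (S n).1).dom) → (S n).2.length = n + 1 →
        𝕂.Extends (S n) (Denumerable.ofNat Task n.unpair.1) (S (n + 1)) := fun n h1 h2 =>
      hS n ▸ hf _ _ (Sim.refl h1) (List.ne_nil_of_length_eq_add_one h2)
    intro n
    induction n with
    | zero =>
      have h1 : ∀ y ∈ (S 0).2, y ∈ (𝕂.struct (S 0).1).dom := by simpa [S] using ha
      exact ⟨h1, rfl, step 0 h1 rfl⟩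
    | succ n ih =>
      have h1 : ∀ y ∈ (S (n + 1)).2, y ∈ (𝕂.struct (S (n + 1)).1).dom :=
        fun y hy => ih.2.2.2.1.mem_dom hy
      have h2 : (S (n + 1)).2.length = n + 1 + 1 := by rw [ih.2.2.1, ih.2.1]
      exact ⟨h1, h2, step (n + 1) h1 h2⟩
  refine ⟨(i, [a]), ⟨fun n => (S n).1, fun n => (S n).2, fun n => (inv n).2.1, fun n => (inv n).1,
    fun n => ?_, fun n p j c c' hc' h => ?_⟩, fun n => rfl⟩
  · simpa [(inv n).2.1] using (inv n).2.2.2.2.1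
  · let m := Nat.pair (Encodable.encode (α := Task) (p, j, c, c')) (n + p.sum)
    have hm : n + p.sum ≤ m := Nat.right_le_pair _ _
    have := (inv m).2.2.2.2.2
    simp only [m, Nat.unpair_pair, Denumerable.ofNat_encode] at this
    refine ⟨m, by omega, ?_⟩
    have h' := this ?_ (h m (by omega)) hc'
    · rwa [(inv m).2.1] at h'
    · rw [(inv m).2.1]; omega

end ComputableAge

/-! ### The limit of a rich sequence -/

namespace ComputableAge.RichSequence

open NatStructure FirstOrder.Language.Structure Filter

variable {L : FirstOrder.Language.{u, v}} {ρ : ComputableLanguage L}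
  {K : Set (Bundled.{0} L.Structure)} {𝕂 : ComputableAge ρ K} (R : 𝕂.RichSequence)

/-- The structure at stage `n`. -/
abbrev stage (n : ℕ) : NatStructure L := 𝕂.struct (R.index n)

/-- The element represented by position `p` at stage `n`. -/
def val (n p : ℕ) : (R.stage n).dom :=
  ⟨pick (R.word n) p, R.mem_dom n _
    (pick_mem (List.ne_nil_of_length_eq_add_one (R.length_word n)) p)⟩

/-- Consecutive words are similar on their common positions; compose these similarities. This
replaces the embeddings of a direct limit. -/
theorem val_coherent {ι : Type*} {v : ι → ℕ} {m n : ℕ} (hmn : m ≤ n) (hv : ∀ i, v i ≤ m) :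
    SameType L (fun i => R.val m (v i)) (fun i => R.val n (v i)) := by
  induction n, hmn using Nat.le_induction with
  | base => exact .of_jointEmbedding (Embedding.refl L _) (Embedding.refl L _) fun _ => rfl
  | succ n hmn ih =>
    refine ih.trans ?_
    obtain ⟨P, h1, h2, h⟩ := sim_iff_exists_pairs.1 (R.sim_succ n)
    have hP : P.length = n + 1 := by simpa [R.length_word] using (congrArg List.length h1).symm
    have hlt : ∀ i, v i < P.length := fun i => by have := hv i; omega
    convert! h.comp fun i => ⟨P[v i]'(hlt i), List.getElem_mem _⟩ using 2 with i i
    · refine Subtype.ext ?_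
      have : v i < (R.word n).length := by rw [R.length_word, ← hP]; exact hlt i
      simp only [val]
      rw [pick_of_lt this]
      simp [h1]
    · refine Subtype.ext ?_
      have h3 : v i < (R.word (n + 1)).length := by
        have := hlt i
        rw [R.length_word]; omega
      have h4 : (R.word (n + 1))[v i] = ((R.word (n + 1)).take (n + 1))[v i]'(by
        have := hlt i
        simp [R.length_word]; omega) := by simp
      simp only [val]
      rw [pick_of_lt h3, h4]
      simp [h2]
    · exact hlt i

/-- The underlying set of the limit: the positions at which an element occurs for the first time. -/
def dom : Set ℕ := {p | ∀ q < p, R.val p q ≠ R.val p p}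

theorem val_eq_iff {m n p q : ℕ} (hmn : m ≤ n) (hp : p ≤ m) (hq : q ≤ m) :
    R.val m p = R.val m q ↔ R.val n p = R.val n q := by
  -- Two elements are compared as a family indexed by `Bool`.
  have := R.val_coherent (v := fun b : Bool => bif b then p else q) hmn (by simp [hp, hq])
  exact this.apply_eq_iff true false

theorem val_injOn {n p q : ℕ} (hp : p ∈ R.dom) (hq : q ∈ R.dom) (hpn : p ≤ n) (hqn : q ≤ n)
    (h : R.val n p = R.val n q) : p = q := by
  rcases lt_trichotomy p q with hlt | rfl | hlt
  · exact (hq p hlt ((R.val_eq_iff hqn hlt.le le_rfl).2 h)).elim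
  · rfl
  · exact (hp q hlt ((R.val_eq_iff hpn hlt.le le_rfl).2 h.symm)).elim

theorem exists_mem_dom (p : ℕ) : ∃ q ∈ R.dom, q ≤ p ∧ ∀ n, p ≤ n → R.val n q = R.val n p := by
  classical
  have h : ∃ q, q ≤ p ∧ R.val p q = R.val p p := ⟨p, le_rfl, rfl⟩
  refine ⟨Nat.find h, fun r hr hrq => ?_, (Nat.find_spec h).1, fun n hn =>
    (R.val_eq_iff hn (Nat.find_spec h).1 le_rfl).1 (Nat.find_spec h).2⟩
  refine Nat.find_min h hr ⟨hr.le.trans (Nat.find_spec h).1, ?_⟩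
  exact ((R.val_eq_iff (Nat.find_spec h).1 hr.le le_rfl).1 hrq).trans (Nat.find_spec h).2

/-- Richness is applied to the structure of stage `n` itself, with the arguments as `c` and the
function value as `c'`: a later position then represents the value. -/
theorem exists_funMap_eq {k : ℕ} (F : L.Functions k) (x : Fin k → ℕ) :
    ∃ q n, (∀ j, x j ≤ n) ∧ q ≤ n ∧ funMap F (fun j => R.val n (x j)) = R.val n q := by
  let n := ∑ j, x j
  have hn : ∀ j, x j ≤ n := fun j => Finset.single_le_sum (fun _ _ => Nat.zero_le _)
    (Finset.mem_univ j)
  let y := funMap F fun j => R.val n (x j)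
  obtain ⟨m, hm, h⟩ := R.rich n (List.ofFn x) (R.index n) (List.ofFn fun j => (R.val n (x j) : ℕ))
    y y.2 fun m hm => by
      rw [List.map_ofFn]
      exact sim_ofFn_iff.2 (R.val_coherent hm hn).symm
  refine ⟨m + 1, m + 1, fun j => (hn j).trans (by omega), le_rfl, ?_⟩
  have h' : SameType L (Fin.cons y fun j => R.val n (x j) : Fin (k + 1) → (R.stage n).dom)
      (Fin.cons (R.val (m + 1) (m + 1)) fun j => R.val (m + 1) (x j)) := by
    rw [← sim_ofFn_iff]
    simpa [List.ofFn_succ, List.map_ofFn, Function.comp_def, val] using h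
  exact (h'.funMap_eq_iff F Fin.succ 0).1 rfl

theorem funMap_val_iff {k : ℕ} (F : L.Functions k) {x : Fin k → ℕ} {q m n : ℕ} (hmn : m ≤ n)
    (hx : ∀ j, x j ≤ m) (hq : q ≤ m) : funMap F (fun j => R.val m (x j)) = R.val m q ↔
      funMap F (fun j => R.val n (x j)) = R.val n q := by
  have := R.val_coherent (v := (Fin.cons q x : Fin (k + 1) → ℕ)) hmn (Fin.cases hq hx)
  exact this.funMap_eq_iff F Fin.succ 0

theorem exists_funMap_eq_mem_dom {k : ℕ} (F : L.Functions k) (x : Fin k → ℕ) :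
    ∃ q ∈ R.dom, ∃ n, (∀ j, x j ≤ n) ∧ q ≤ n ∧ funMap F (fun j => R.val n (x j)) = R.val n q := by
  obtain ⟨q, n, hx, hq, h⟩ := R.exists_funMap_eq F x
  obtain ⟨r, hr, hrq, hv⟩ := R.exists_mem_dom q
  exact ⟨r, hr, n, hx, hrq.trans hq, h.trans (hv n hq).symm⟩

/-- The limit of a rich sequence. -/
noncomputable def limit : NatStructure L where
  dom := R.dom
  str :=
    { funMap := fun F x => ⟨_, (R.exists_funMap_eq_mem_dom F fun j => (x j : ℕ)).choose_spec.1⟩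
      RelMap := fun r x => ∃ n, (∀ j, (x j : ℕ) ≤ n) ∧ RelMap r fun j => R.val n (x j) }

theorem funMap_limit {k : ℕ} (F : L.Functions k) (x : Fin k → R.limit.dom) :
    ∃ n, (∀ j, (x j : ℕ) ≤ n) ∧ (funMap F x : R.limit.dom) ≤ n ∧
      funMap F (fun j => R.val n (x j)) = R.val n (funMap F x : R.limit.dom) :=
  (R.exists_funMap_eq_mem_dom F fun j => (x j : ℕ)).choose_spec.2

theorem eventually_funMap {k : ℕ} (F : L.Functions k) (x : Fin k → R.limit.dom) :
    ∀ᶠ n in atTop, funMap F (fun j => R.val n (x j)) = R.val n (funMap F x : R.limit.dom) := by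
  obtain ⟨m, h1, h2, h3⟩ := R.funMap_limit F x
  filter_upwards [eventually_ge_atTop m] with n hn
  exact (R.funMap_val_iff F hn h1 h2).1 h3

/-- The stage has to depend on the term, since the values of its subterms may be represented only at
large positions. -/
theorem eventually_realize {ι : Type*} (v : ι → R.limit.dom) (t : L.Term ι) :
    ∀ᶠ n in atTop, t.realize (fun i => R.val n (v i)) = R.val n (t.realize v : R.limit.dom) := by
  induction t with
  | var i => exact .of_forall fun n => rfl
  | func F t ih =>
    filter_upwards [eventually_all.2 ih, R.eventually_funMap F fun j => (t j).realize v]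
      with n h1 h2
    simp only [Term.realize_func, h1, h2]

theorem relMap_limit_iff {k : ℕ} (r : L.Relations k) (x : Fin k → R.limit.dom) :
    RelMap r x ↔ ∀ᶠ n in atTop, RelMap r fun j => R.val n (x j) := by
  have key : ∀ {m n}, m ≤ n → (∀ j, (x j : ℕ) ≤ m) →
      ((RelMap r fun j => R.val m (x j)) ↔ RelMap r fun j => R.val n (x j)) := fun hmn hx =>
    (R.val_coherent hmn hx).relMap_iff r id
  constructor
  · rintro ⟨m, hx, h⟩
    filter_upwards [eventually_ge_atTop m] with n hn
    exact (key hn hx).1 h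
  · intro h
    obtain ⟨n, h1, h2⟩ := (h.and (eventually_all.2 fun j => eventually_ge_atTop (x j : ℕ))).exists
    exact ⟨n, h2, h1⟩

/-- A family in the limit has the same atomic type as its values at any late enough stage. -/
theorem sameType_val {ι : Type*} (v : ι → R.limit.dom) {n : ℕ} (hn : ∀ i, (v i : ℕ) ≤ n) :
    SameType L v fun i => R.val n (v i) := by
  have key : ∀ m ≥ n, SameType L (fun i => R.val n (v i)) fun i => R.val m (v i) :=
    fun m hm => R.val_coherent hm hn
  refine ⟨fun t u => ?_, fun {k} r t => ?_⟩
  -- At a stage where both term values are present, `val` is injective on the domain, so equality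
  -- there is equality in the limit.
  · obtain ⟨m, h1, h2, h3, h4, h5⟩ := ((eventually_ge_atTop n).and
      ((R.eventually_realize v t).and ((R.eventually_realize v u).and
      ((eventually_ge_atTop (t.realize v : R.limit.dom).1).and
      (eventually_ge_atTop (u.realize v : R.limit.dom).1))))).exists
    rw [(key m h1).eq_iff, h2, h3]
    refine ⟨fun h => by rw [h], fun h => Subtype.ext ?_⟩
    exact R.val_injOn (t.realize v).2 (u.realize v).2 h4 h5 h
  · rw [R.relMap_limit_iff]
    have : ∀ᶠ m in atTop, (RelMap r fun j => R.val m ((t j).realize v : R.limit.dom)) ↔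
        RelMap r fun j => (t j).realize fun i => R.val n (v i) := by
      filter_upwards [eventually_ge_atTop n,
        eventually_all.2 fun j => R.eventually_realize v (t j)] with m h1 h2
      rw [(key m h1).rel_iff]
      simp only [h2]
    -- The right-hand side does not mention `m`, so holding eventually is holding.
    rw [eventually_congr this, eventually_const]

theorem sim_val {a : List ℕ} (ha : ∀ x ∈ a, x ∈ R.limit.dom) {n : ℕ} (hn : ∀ x ∈ a, x ≤ n) :
    Sim R.limit (R.stage n) a (a.map (pick (R.word n))) := by
  have := Sim.of_sameType (R.sameType_val (fun x : {x // x ∈ a} => ⟨x.1, ha _ x.2⟩)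
    fun x => hn _ x.2) a.attach
  simpa [val] using this

theorem exists_sim_cons {a c : List ℕ} {j c' : ℕ} (h : Sim R.limit (𝕂.struct j) a c)
    (hc' : c' ∈ (𝕂.struct j).dom) :
    ∃ y, Sim R.limit (𝕂.struct j) (y :: a) (c' :: c) := by
  have ha : ∀ x ∈ a, x ∈ R.limit.dom := fun x => h.mem_dom
  have hs : ∀ {m}, a.sum ≤ m → ∀ x ∈ a, x ≤ m := fun hm x hx => (List.le_sum_of_mem hx).trans hm
  obtain ⟨m, hm, h'⟩ := R.rich a.sum a j c c' hc' fun m hm => (R.sim_val ha (hs hm)).symm.trans h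
  -- The new entry may repeat an older one; its first occurrence is the element of the limit.
  obtain ⟨y, hy, hym, hv⟩ := R.exists_mem_dom (m + 1)
  refine ⟨y, Sim.trans ?_ h'.symm⟩
  have h1 : Sim R.limit (R.stage (m + 1)) (y :: a) ((y :: a).map (pick (R.word (m + 1)))) :=
    R.sim_val (by simpa using ⟨hy, ha⟩)
      (by simpa using ⟨hym, hs (by omega)⟩)
  have h2 : pick (R.word (m + 1)) y = pick (R.word (m + 1)) (m + 1) :=
    congrArg Subtype.val (hv _ le_rfl)
  rwa [List.map_cons, h2] at h1

/-- Copy `x :: a` into a stage that has all its positions. Then `b` is similar to the copy of `a` in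
a listed structure, and richness adds the copy of `x`. -/
theorem exists_sim_limit_cons {a b : List ℕ} {x : ℕ} (h : Sim R.limit R.limit a b)
    (hx : x ∈ R.limit.dom) : ∃ y, Sim R.limit R.limit (x :: a) (y :: b) := by
  have ha : ∀ z ∈ x :: a, z ∈ R.limit.dom := by
    simpa using ⟨hx, fun z => h.mem_dom⟩
  have h1 := R.sim_val ha (n := (x :: a).sum) fun z => List.le_sum_of_mem
  obtain ⟨y, hy⟩ := R.exists_sim_cons (c' := pick (R.word (x :: a).sum) x)
    (h.symm.trans h1.tail) (h1.symm.mem_dom (by simp))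
  exact ⟨y, h1.trans hy.symm⟩

end ComputableAge.RichSequence

/-! ### The age of the limit, and automorphisms from increasing sequences of partial maps -/

section Generation

open FirstOrder.Language.Structure FirstOrder.Language.Substructure

variable {L : FirstOrder.Language.{u, v}} {ι A B : Type*} [L.Structure A] [L.Structure B]

theorem SameType.exists_embedding_of_closure_eq_top {a : ι → A} {b : ι → B} (h : SameType L a b)
    (ha : closure L (Set.range a) = ⊤) : ∃ e : A ↪[L] B, ∀ i, e (a i) = b i := by
  obtain ⟨e, he⟩ := h.exists_embedding
  have h' : ∀ x, x ∈ closure L (Set.range a) := fun x => ha ▸ Substructure.mem_top x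
  refine ⟨e.comp ((inclusion (show (⊤ : L.Substructure A) ≤ closure L (Set.range a) from
    fun x _ => h' x)).comp topEquiv.symm.toEmbedding), fun i => ?_⟩
  rw [← he]
  rfl

theorem isUltrahomogeneous_of_sameAtomicType {M : Type} [L.Structure M]
    (h : ∀ (n : ℕ) (a b : Fin n → M), SameAtomicType (L := L) a b →
      ∃ α : M ≃[L] M, ∀ k, α (a k) = b k) : L.IsUltrahomogeneous M := by
  intro S hS f
  obtain ⟨n, a, rfl⟩ := fg_iff_exists_fin_generating_family.1 hS
  let a' : Fin n → closure L (Set.range a) := fun k => ⟨a k, subset_closure ⟨k, rfl⟩⟩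
  obtain ⟨α, hα⟩ := h n a (f ∘ a') (sameAtomicType_iff.2
    (.trans (SameType.of_embedding (Substructure.subtype _) a').symm (.of_embedding f a')))
  refine ⟨α, ?_⟩
  -- The set where `f` and the automorphism agree is a substructure; it is pushed into `M` so that
  -- it suffices to check generators.
  have key : closure L (Set.range a) ≤ (f.toHom.eqLocus
      (α.toEmbedding.comp (Substructure.subtype _)).toHom).map (Substructure.subtype _).toHom := by
    rw [closure_le]
    rintro _ ⟨k, rfl⟩
    exact ⟨a' k, (hα k).symm, rfl⟩
  ext x
  obtain ⟨y, hy, hyx⟩ := key x.2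
  obtain rfl : y = x := Subtype.ext hyx
  exact hy

end Generation

namespace NatStructure

open FirstOrder.Language.Structure

variable {L : FirstOrder.Language.{u, v}} {A B M : NatStructure L}

theorem Sim.sameType_of_mem {l : List (ℕ × ℕ)} (h : Sim A B (l.map Prod.fst) (l.map Prod.snd))
    {ι : Type*} {v : ι → A.dom} {w : ι → B.dom} (hvw : ∀ i, ((v i : ℕ), (w i : ℕ)) ∈ l) :
    SameType L v w := by
  obtain ⟨P, h1, h2, h⟩ := sim_iff_exists_pairs.1 h
  have hl : l = P.map fun q => ((q.1 : ℕ), (q.2 : ℕ)) := by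
    have h3 : l.length = P.length := by simpa using congrArg List.length h1
    refine List.ext_getElem (by simpa) fun k hk hk' => ?_
    have h4 := List.getElem_of_eq h1 (i := k) (by simpa)
    have h5 := List.getElem_of_eq h2 (i := k) (by simpa)
    simp only [List.getElem_map] at h4 h5 ⊢
    exact Prod.ext h4 h5
  have hP : ∀ i, (v i, w i) ∈ P := fun i => by
    have := hvw i
    rw [hl, List.mem_map] at this
    obtain ⟨q, hq, hqi⟩ := this
    obtain rfl : q = (v i, w i) := Prod.ext (Subtype.ext (congrArg Prod.fst hqi))
      (Subtype.ext (congrArg Prod.snd hqi))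
    exact hq
  exact h.comp fun i => ⟨(v i, w i), hP i⟩

/-- The union of an increasing sequence of finite partial isomorphisms that exhausts both sides
is an automorphism. -/
theorem exists_automorphism {Q : ℕ → List (ℕ × ℕ)}
    (hQ : ∀ n, Sim M M ((Q n).map Prod.fst) ((Q n).map Prod.snd)) (mono : ∀ n, Q n ⊆ Q (n + 1))
    (total : ∀ x ∈ M.dom, ∃ n y, (x, y) ∈ Q n) (surj : ∀ y ∈ M.dom, ∃ n x, (x, y) ∈ Q n) :
    ∃ σ : Equiv.Perm M.dom, (∀ x y, (∃ n, (x, y) ∈ Q n) ↔ ∃ h : x ∈ M.dom, (σ ⟨x, h⟩ : ℕ) = y) ∧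
      ∃ α : M.dom ≃[L] M.dom, ∀ x, α x = σ x := by
  have mono' : ∀ {m n}, m ≤ n → Q m ⊆ Q n := fun {m n} h => by
    induction n, h using Nat.le_induction with
    | base => exact List.Subset.refl _
    | succ n _ ih => exact List.Subset.trans ih (mono n)
  have hd : ∀ {n x y}, (x, y) ∈ Q n → x ∈ M.dom ∧ y ∈ M.dom := fun {n x y} h =>
    ⟨(hQ n).mem_dom (List.mem_map.2 ⟨_, h, rfl⟩), (hQ n).symm.mem_dom (List.mem_map.2 ⟨_, h, rfl⟩)⟩
  -- Finitely many pairs of the union already lie in one `Q n`. Two-element families give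
  -- well-definedness and injectivity; families of arguments and values give preservation of
  -- functions and relations.
  have same : ∀ {ι : Type} [Finite ι] {v w : ι → M.dom},
      (∀ i, ∃ n, ((v i : ℕ), (w i : ℕ)) ∈ Q n) → SameType L v w := fun {ι} _ {v w} h => by
    choose N hN using h
    obtain ⟨n, hn⟩ := Finite.exists_le N
    exact (hQ n).sameType_of_mem fun i => mono' (hn i) (hN i)
  have hex : ∀ x : M.dom, ∃ y : M.dom, ∃ n, ((x : ℕ), (y : ℕ)) ∈ Q n := fun x => by
    obtain ⟨n, y, h⟩ := total x x.2
    exact ⟨⟨y, (hd h).2⟩, n, h⟩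
  choose f hf using hex
  have inj : ∀ {x x' y y' : M.dom}, (∃ n, ((x : ℕ), (y : ℕ)) ∈ Q n) →
      (∃ n, ((x' : ℕ), (y' : ℕ)) ∈ Q n) → (x = x' ↔ y = y') := fun {x x' y y'} h h' =>
    (same (ι := Bool) (v := fun i => bif i then x else x') (w := fun i => bif i then y else y')
      (Bool.forall_bool.2 ⟨h', h⟩)).apply_eq_iff true false
  have bij : Function.Bijective f := by
    refine ⟨fun x x' h => (inj (hf x) (hf x')).2 h, fun y => ?_⟩
    obtain ⟨n, x, h⟩ := surj y y.2
    exact ⟨⟨x, (hd h).1⟩, (inj (hf _) ⟨n, h⟩).1 rfl⟩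
  refine ⟨Equiv.ofBijective f bij, fun x y => ⟨?_, ?_⟩, ⟨⟨Equiv.ofBijective f bij, ?_, ?_⟩, ?_⟩⟩
  · rintro ⟨n, h⟩
    exact ⟨(hd h).1, congrArg Subtype.val
      ((inj (hf ⟨x, (hd h).1⟩) (y' := ⟨y, (hd h).2⟩) ⟨n, h⟩).1 rfl)⟩
  · rintro ⟨h, rfl⟩
    exact hf ⟨x, h⟩
  · intro n F x
    have h : SameType L (Fin.cons (funMap F x) x : Fin (n + 1) → M.dom)
        (Fin.cons (f (funMap F x)) fun j => f (x j)) :=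
      same (Fin.cases (hf _) fun j => hf _)
    exact ((h.funMap_eq_iff F Fin.succ 0).1 rfl).symm
  · intro n r x
    exact ((same (v := x) (w := fun j => f (x j)) fun j => hf _).relMap_iff r id).symm
  · exact fun x => rfl

end NatStructure

/-! ### The age of the limit -/

namespace ComputableAge.RichSequence

open NatStructure FirstOrder.Language.Structure FirstOrder.Language.Substructure

variable {L : FirstOrder.Language.{u, v}} {ρ : ComputableLanguage L}
  {K : Set (Bundled.{0} L.Structure)} {𝕂 : ComputableAge ρ K} (R : 𝕂.RichSequence)

theorem exists_sim_of_forall_mem (hJEP : JointEmbedding K) {j : ℕ} {c : List ℕ}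
    (hc : ∀ x ∈ c, x ∈ (𝕂.struct j).dom) : ∃ a, Sim R.limit (𝕂.struct j) a c := by
  induction c with
  | nil => exact ⟨[], (R.sim_val (a := []) (n := 0) (by simp) (by simp)).trans (𝕂.sim_nil hJEP _ _)⟩
  | cons x c ih =>
    obtain ⟨a, ha⟩ := ih fun y hy => hc y (List.mem_cons_of_mem _ hy)
    obtain ⟨y, hy⟩ := R.exists_sim_cons ha (hc x List.mem_cons_self)
    exact ⟨_, hy⟩

/-- The generators of a finitely generated substructure have the same type at a late stage, so it
embeds into a structure of the age. Conversely, a copy in the limit of the generating tuple of a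
listed structure gives an embedding of that structure. -/
theorem age_limit (hK : IsAge K) (hHP : Hereditary K) (hJEP : JointEmbedding K) :
    L.age R.limit.dom = K := by
  ext N
  constructor
  · rintro ⟨hfg, ⟨e⟩⟩
    obtain ⟨n, a, ha⟩ := fg_iff_exists_fin_generating_family.1 hfg.out
    let m := ∑ k, (e (a k) : ℕ)
    have hm : ∀ k, (e (a k) : ℕ) ≤ m := fun k =>
      Finset.single_le_sum (f := fun k => (e (a k) : ℕ)) (fun _ _ => Nat.zero_le _)
        (Finset.mem_univ k)
    obtain ⟨g, -⟩ := ((SameType.of_embedding e a).trans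
      (R.sameType_val (e ∘ a) hm)).exists_embedding_of_closure_eq_top ha
    exact hHP _ (𝕂.mem_age (R.index m)) ⟨hfg, ⟨g⟩⟩
  · intro hN
    obtain ⟨j, ⟨e⟩⟩ := 𝕂.exhausts N hN
    obtain ⟨a, h⟩ := R.exists_sim_of_forall_mem hJEP (𝕂.tuple_mem j)
    obtain ⟨P, h1, h2, h⟩ := sim_iff_exists_pairs.1 h
    have hP : closure L (Set.range fun q : {q // q ∈ P} => q.1.2) = ⊤ := by
      rw [← 𝕂.generates j]
      congr 1
      ext x
      rw [Set.mem_ofPred_eq, h2]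
      simp
    obtain ⟨g, -⟩ := h.symm.exists_embedding_of_closure_eq_top hP
    exact ⟨hK.fg N hN, ⟨g.comp e.toEmbedding⟩⟩

end ComputableAge.RichSequence

/-! ### Computability of the limit -/

theorem primrec₂_pick : Primrec₂ pick :=
  (Primrec.option_getD.comp (Primrec.list_getElem?.comp .fst .snd)
    (Primrec.list_headI.comp .fst)).of_eq fun _ => (List.getD_eq_getElem?_getD ..).symm

theorem primrec₂_map_pick : Primrec₂ fun w p : List ℕ => p.map (pick w) :=
  Primrec.list_map .snd (primrec₂_pick.comp (Primrec.fst.comp .fst) .snd)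

theorem primrec_list_sum : Primrec (List.sum : List ℕ → ℕ) :=
  (Primrec.list_foldr (h := fun _ q => q.1 + q.2) .id (.const 0)
    (Primrec.nat_add.comp (Primrec.fst.comp .snd) (Primrec.snd.comp .snd))).of_eq fun l => by
    induction l <;> simp_all

/-- Being a first occurrence becomes an equation between primitive recursive functions of the word
and the position. -/
theorem List.idxOf_pick_eq_iff {w : List ℕ} {p : ℕ} (hp : p < w.length) :
    w.idxOf (pick w p) = p ↔ ∀ q < p, pick w q ≠ pick w p := by
  rw [pick_of_lt hp]
  have h1 := (List.mem_take_iff_idxOf_lt (n := p + 1) (List.getElem_mem hp)).1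
    (List.mem_take_iff_getElem.2 ⟨p, by omega, rfl⟩)
  have h2 := List.mem_take_iff_idxOf_lt (n := p) (List.getElem_mem hp)
  rw [List.mem_take_iff_getElem] at h2
  constructor
  · intro h q hq hpq
    rw [pick_of_lt (hq.trans hp)] at hpq
    exact absurd (h2.1 ⟨q, by omega, hpq⟩) (by omega)
  · intro h
    have : ¬ w.idxOf w[p] < p := fun hlt => by
      obtain ⟨q, hq, hpq⟩ := h2.2 hlt
      exact h q (by omega) (by rwa [pick_of_lt (by omega)])
    omega

theorem List.map_eq_self_iff {α : Type*} {l : List α} {f : α → α} :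
    l.map f = l ↔ ∀ x ∈ l, f x = x := by
  induction l <;> simp_all

theorem charFun_decidableIn {α : Type} [Primcodable α] {A : Set α} {s : ℕ →. ℕ}
    (h : charFun A ≤ᵀ s) : DecidableIn s fun a => a ∈ A := by
  classical
  have h1 : ComputableIn {s} fun n : ℕ => if ∃ a ∈ A, Encodable.encode a = n then 1 else 0 := by
    convert! h using 3
  refine (DecidableIn.eq (h1.comp (Primrec.encode (α := α)).computableIn)
    (ComputableIn.const 1)).of_iff fun a => ?_
  simp [Encodable.encode_inj]

namespace ComputableAge

open NatStructure

variable {L : FirstOrder.Language.{u, v}} {ρ : ComputableLanguage L}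
  {K : Set (Bundled.{0} L.Structure)} {𝕂 : ComputableAge ρ K} {s : ℕ →. ℕ}

/-- `Sim` between listed structures unfolds to membership in `embedInfo`, so this is a single query.
-/
theorem decidableIn_sim (hE : charFun 𝕂.embedInfo ≤ᵀ s) {α : Type} [Primcodable α]
    {f g : α → ℕ × List ℕ} (hf : ComputableIn {s} f) (hg : ComputableIn {s} g) :
    DecidableIn s fun x => Sim (𝕂.struct (f x).1) (𝕂.struct (g x).1) (f x).2 (g x).2 :=
  (charFun_decidableIn hE).comp (hf.pair hg)

/-- The two premises, themselves decidable, make the relation total in `q.2`, as the search in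
`exists_selector` requires. -/
theorem decidableIn_extends (hE : charFun 𝕂.embedInfo ≤ᵀ s) :
    DecidableIn s fun q : (Stage × Task) × Stage =>
      Sim (𝕂.struct q.1.1.1) (𝕂.struct q.1.1.1) q.1.1.2 q.1.1.2 → q.1.1.2 ≠ [] →
        𝕂.Extends q.1.1 q.1.2 q.2 := by
  have x : Primrec fun q : (Stage × Task) × Stage => q.1.1 := Primrec.fst.comp .fst
  have t : Primrec fun q : (Stage × Task) × Stage => q.1.2 := Primrec.snd.comp .fst
  have y : Primrec fun q : (Stage × Task) × Stage => q.2 := Primrec.snd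
  have x1 := Primrec.fst.comp x
  have x2 := Primrec.snd.comp x
  have t1 := Primrec.fst.comp t
  have t2 := Primrec.snd.comp t
  have j := Primrec.fst.comp t2
  have c := Primrec.fst.comp (Primrec.snd.comp t2)
  have c' := Primrec.snd.comp (Primrec.snd.comp t2)
  have y1 := Primrec.fst.comp y
  have y2 := Primrec.snd.comp y
  have len := Primrec.list_length.comp x2
  have sim : ∀ {f g : (Stage × Task) × Stage → ℕ × List ℕ}, Primrec f → Primrec g →
      DecidableIn s fun q => Sim (𝕂.struct (f q).1) (𝕂.struct (g q).1) (f q).2 (g q).2 :=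
    fun hf hg => decidableIn_sim hE hf.computableIn hg.computableIn
  refine (sim x x).imp (.imp (.not (.eq x2.computableIn (.const []))) (.and ?_ (.and (sim y y)
    (.and (sim x (y1.pair (Primrec.list_take.comp len y2))) (.imp ?_ (.imp
    (sim (x1.pair (primrec₂_map_pick.comp x2 t1)) (j.pair c)) (.imp ?_
    (sim (j.pair (Primrec.list_cons.comp c' c)) (y1.pair (Primrec.list_cons.comp
      (primrec₂_pick.comp y2 len) (primrec₂_map_pick.comp y2 t1)))))))))))
  · exact .eq (Primrec.list_length.comp y2).computableIn (Primrec.succ.comp len).computableIn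
  · exact .of_computablePred
      (PrimrecPred.computablePred (Primrec.nat_lt.comp (primrec_list_sum.comp t1) len))
  · exact (DecidableIn.of_computablePred 𝕂.dom_computable).comp (j.pair c').computableIn

theorem exists_computable_richSequence (hHP : Hereditary K) (hAP : Amalgamation K)
    (hne : ∃ i, (𝕂.struct i).dom.Nonempty) : ∃ R : 𝕂.RichSequence,
      ComputableIn {charFun 𝕂.embedInfo} fun n => (R.index n, R.word n) := by
  obtain ⟨f, hf, hf'⟩ := (decidableIn_extends (𝕂 := 𝕂) .rfl).exists_selector fun q => by
    by_cases h : Sim (𝕂.struct q.1.1) (𝕂.struct q.1.1) q.1.2 q.1.2 ∧ q.1.2 ≠ []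
    · obtain ⟨y, hy⟩ := 𝕂.exists_extends hHP hAP (fun n => h.1.mem_dom) h.2 q.2
      exact ⟨y, fun _ _ => hy⟩
    · exact ⟨(0, []), fun h1 h2 => (h ⟨h1, h2⟩).elim⟩
  obtain ⟨x, R, hR⟩ := 𝕂.exists_richSequence hne (f := f) fun x t => hf' (x, t)
  refine ⟨R, .of_eq ?_ fun n => (hR n).symm⟩
  have m : Primrec fun q : ℕ × (ℕ × Stage) => q.2.1 := Primrec.fst.comp .snd
  have y : Primrec fun q : ℕ × (ℕ × Stage) => q.2.2 := Primrec.snd.comp .snd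
  exact ComputableIn.nat_rec (f := fun n : ℕ => n)
    (h := fun q => f (q.2.2, Denumerable.ofNat Task q.2.1.unpair.1)) ComputableIn.id (.const x)
    (hf.comp (y.pair ((Primrec.ofNat Task).comp
      (Primrec.fst.comp (Primrec.unpair.comp m)))).computableIn)

/-! ### Reading the limit off its stages -/

namespace RichSequence

open FirstOrder.Language.Structure

variable (R : 𝕂.RichSequence)

theorem mem_dom_iff {n p : ℕ} (h : p ≤ n) :
    p ∈ R.limit.dom ↔ (R.word n).idxOf (pick (R.word n) p) = p := by
  rw [List.idxOf_pick_eq_iff (by rw [R.length_word]; omega)]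
  refine forall₂_congr fun q hq => not_congr ?_
  rw [R.val_eq_iff h hq.le le_rfl]
  exact Subtype.ext_iff

theorem forall_mem_dom_iff {n : ℕ} {a : List ℕ} (h : a.sum ≤ n) :
    (∀ x ∈ a, x ∈ R.limit.dom) ↔
      a.map (fun p => (R.word n).idxOf (pick (R.word n) p)) = a := by
  rw [List.map_eq_self_iff]
  exact forall₂_congr fun x hx => R.mem_dom_iff ((List.le_sum_of_mem hx).trans h)

variable {R} {α : Type} [Primcodable α]

section

variable (hR : ComputableIn {s} fun n => (R.index n, R.word n))
include hR

theorem computableIn_index {f : α → ℕ} (hf : ComputableIn {s} f) :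
    ComputableIn {s} fun x => R.index (f x) :=
  ComputableIn.fst.comp (hR.comp hf)

theorem computableIn_word {f : α → ℕ} (hf : ComputableIn {s} f) :
    ComputableIn {s} fun x => R.word (f x) :=
  ComputableIn.snd.comp (hR.comp hf)

theorem decidableIn_forall_mem_dom {a : α → List ℕ} (ha : ComputableIn {s} a) :
    DecidableIn s fun x => ∀ y ∈ a x, y ∈ R.limit.dom := by
  have h1 : Primrec fun q : List ℕ × List ℕ => q.2.map fun p => q.1.idxOf (pick q.1 p) := by
    have w : Primrec fun q : (List ℕ × List ℕ) × ℕ => q.1.1 := Primrec.fst.comp .fst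
    exact Primrec.list_map .snd (Primrec.list_idxOf.comp (primrec₂_pick.comp w .snd) w)
  have h2 := computableIn_word hR (primrec_list_sum.computableIn.comp ha)
  exact (DecidableIn.eq (h1.computableIn.comp (h2.pair ha)) ha).of_iff fun x =>
    (R.forall_mem_dom_iff le_rfl).symm

theorem decidableIn_mem_dom : DecidableIn s fun x => x ∈ R.limit.dom :=
  (decidableIn_forall_mem_dom hR (a := fun x => [x])
    (Primrec.list_cons.comp .id (.const [])).computableIn).of_iff fun x => by simp

theorem computableIn_map_pick {f : α → ℕ} {a : α → List ℕ} (hf : ComputableIn {s} f)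
    (ha : ComputableIn {s} a) : ComputableIn {s} fun x => (a x).map (pick (R.word (f x))) :=
  primrec₂_map_pick.computableIn₂.comp ((computableIn_word hR hf).pair ha)

/-- Both tuples are moved to one stage past all their entries, where one query compares them.
Membership in the domain is tested separately, since every number has a value at that stage. -/
theorem decidableIn_sim_limit (hE : charFun 𝕂.embedInfo ≤ᵀ s) :
    DecidableIn s fun p : List ℕ × List ℕ => Sim R.limit R.limit p.1 p.2 := by
  have happ : ComputableIn {s} fun p : List ℕ × List ℕ => p.1 ++ p.2 :=
    Primrec.list_append.computableIn₂
  have hn : ComputableIn {s} fun p : List ℕ × List ℕ => (p.1 ++ p.2).sum :=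
    primrec_list_sum.computableIn.comp happ
  refine ((decidableIn_forall_mem_dom hR happ).and (decidableIn_sim hE
    ((computableIn_index hR hn).pair (computableIn_map_pick hR hn .fst))
    ((computableIn_index hR hn).pair (computableIn_map_pick hR hn .snd)))).of_iff fun p => ?_
  have key : (∀ x ∈ p.1 ++ p.2, x ∈ R.limit.dom) →
      Sim R.limit (R.stage (p.1 ++ p.2).sum) p.1 (p.1.map (pick (R.word (p.1 ++ p.2).sum))) ∧
      Sim R.limit (R.stage (p.1 ++ p.2).sum) p.2 (p.2.map (pick (R.word (p.1 ++ p.2).sum))) :=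
    fun h => ⟨R.sim_val (fun x hx => h x (List.mem_append_left _ hx))
        fun x hx => List.le_sum_of_mem (List.mem_append_left _ hx),
      R.sim_val (fun x hx => h x (List.mem_append_right _ hx))
        fun x hx => List.le_sum_of_mem (List.mem_append_right _ hx)⟩
  constructor
  · rintro ⟨h1, h2⟩
    exact (key h1).1.trans (h2.trans (key h1).2.symm)
  · intro h
    have h1 : ∀ x ∈ p.1 ++ p.2, x ∈ R.limit.dom := fun x hx =>
      (List.mem_append.1 hx).elim h.mem_dom h.symm.mem_dom
    exact ⟨h1, (key h1).1.symm.trans (h.trans (key h1).2)⟩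

end

theorem exists_family {a : List ℕ} (ha : ∀ x ∈ a, x ∈ R.limit.dom) {k m : ℕ}
    {v : Fin k → (R.stage m).dom} (h : a.map (pick (R.word m)) = List.ofFn fun j => (v j : ℕ)) :
    ∃ x : Fin k → R.limit.dom, a = List.ofFn (fun j => (x j : ℕ)) ∧
      v = fun j => R.val m (x j) := by
  obtain rfl : a.length = k := by simpa using congrArg List.length h
  refine ⟨fun j => ⟨a[j], ha _ (List.getElem_mem _)⟩, by simp, ?_⟩
  refine ofFn_val_injective (h.symm.trans ?_)
  apply List.ext_getElem <;> simp [val]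

/-- Stage `a.sum` has all positions in `a`, and atomic types are the same there as in the limit; so
the diagram of the limit reduces to the uniformly c.e. diagrams of the age. -/
theorem mem_posDiagram_iff {r : ℕ} {a : List ℕ} : (r, a) ∈ R.limit.posDiagram ρ ↔
    (∀ x ∈ a, x ∈ R.limit.dom) ∧
      (r, a.map (pick (R.word a.sum))) ∈ (R.stage a.sum).posDiagram ρ := by
  constructor
  · rintro ⟨h, x, hx, hr⟩
    dsimp only at hx
    have ha : ∀ y ∈ a, y ∈ R.limit.dom := by
      intro y hy; rw [hx] at hy; obtain ⟨j, rfl⟩ := (List.mem_ofFn' _ _).1 hy; exact (x j).2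
    refine ⟨ha, h, fun j => R.val a.sum (x j), by simp [hx, List.map_ofFn, Function.comp_def, val],
      ((R.sameType_val x fun j => ?_).relMap_iff _ id).1 hr⟩
    exact List.le_sum_of_mem (by simp [hx, List.mem_ofFn])
  · rintro ⟨ha, h, v, hv, hr⟩
    obtain ⟨x, hx, rfl⟩ := exists_family ha hv
    refine ⟨h, x, hx, ((R.sameType_val x fun j => ?_).relMap_iff _ id).2 hr⟩
    exact List.le_sum_of_mem (by simp [hx, List.mem_ofFn])

theorem mem_negDiagram_iff {r : ℕ} {a : List ℕ} : (r, a) ∈ R.limit.negDiagram ρ ↔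
    (∀ x ∈ a, x ∈ R.limit.dom) ∧
      (r, a.map (pick (R.word a.sum))) ∈ (R.stage a.sum).negDiagram ρ := by
  constructor
  · rintro ⟨h, x, hx, hr⟩
    dsimp only at hx
    have ha : ∀ y ∈ a, y ∈ R.limit.dom := by
      intro y hy; rw [hx] at hy; obtain ⟨j, rfl⟩ := (List.mem_ofFn' _ _).1 hy; exact (x j).2
    refine ⟨ha, h, fun j => R.val a.sum (x j), by simp [hx, List.map_ofFn, Function.comp_def, val],
      fun h' => hr (((R.sameType_val x fun j => ?_).relMap_iff _ id).2 h')⟩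
    exact List.le_sum_of_mem (by simp [hx, List.mem_ofFn])
  · rintro ⟨ha, h, v, hv, hr⟩
    obtain ⟨x, hx, rfl⟩ := exists_family ha hv
    refine ⟨h, x, hx, fun h' => hr (((R.sameType_val x fun j => ?_).relMap_iff _ id).1 h')⟩
    exact List.le_sum_of_mem (by simp [hx, List.mem_ofFn])

theorem mem_funGraph_iff {r b : ℕ} {a : List ℕ} : (r, a, b) ∈ R.limit.funGraph ρ ↔
    (∀ x ∈ b :: a, x ∈ R.limit.dom) ∧
      (r, a.map (pick (R.word (b :: a).sum)), pick (R.word (b :: a).sum) b) ∈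
        (R.stage (b :: a).sum).funGraph ρ := by
  have key : ∀ {k : ℕ} (F : L.Functions k) (x : Fin k → R.limit.dom) (y : R.limit.dom),
      a = List.ofFn (fun j => (x j : ℕ)) → (y : ℕ) = b → (funMap F x = y ↔
        funMap F (fun j => R.val (b :: a).sum (x j)) = R.val (b :: a).sum y) := by
    intro k F x y hx hy
    have := R.sameType_val (Fin.cons y x : Fin (k + 1) → R.limit.dom) (n := (b :: a).sum)
      (Fin.cases (List.le_sum_of_mem (by simp [hy]))
        fun j => List.le_sum_of_mem (by simp [hx, List.mem_ofFn]))
    exact this.funMap_eq_iff F Fin.succ 0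
  constructor
  · rintro ⟨h, x, hx, hr⟩
    dsimp only at hx hr
    have ha : ∀ y ∈ b :: a, y ∈ R.limit.dom := by
      intro y hy
      rcases List.mem_cons.1 hy with rfl | hy
      · rw [← hr]; exact Subtype.prop _
      · rw [hx] at hy; obtain ⟨j, rfl⟩ := (List.mem_ofFn' _ _).1 hy; exact (x j).2
    refine ⟨ha, h, fun j => R.val (b :: a).sum (x j),
      by simp [hx, List.map_ofFn, Function.comp_def, val], ?_⟩
    rw [(key _ x _ hx hr).1 rfl]
    simp only [val, hr]
  · rintro ⟨ha, h, v, hv, hr⟩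
    obtain ⟨x, hx, rfl⟩ := exists_family (fun y hy => ha y (List.mem_cons_of_mem _ hy)) hv
    refine ⟨h, x, hx, congrArg Subtype.val ((key _ x ⟨b, ha b List.mem_cons_self⟩ hx rfl).2
      (Subtype.ext hr))⟩

theorem isComputableIn_limit (hR : ComputableIn {s} fun n => (R.index n, R.word n)) :
    R.limit.IsComputableIn ρ s := by
  refine ⟨decidableIn_mem_dom hR, ?_, ?_, ?_⟩
  · have ha : ComputableIn {s} fun p : ℕ × List ℕ => p.2 := .snd
    have hn := primrec_list_sum.computableIn.comp ha
    exact ((CEIn.of_decidableIn (decidableIn_forall_mem_dom hR ha)).and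
      ((CEIn.of_rePred 𝕂.pos_ce).comp ((computableIn_index hR hn).pair
        (ComputableIn.fst.pair (computableIn_map_pick hR hn ha))))).of_iff
      fun p => mem_posDiagram_iff.symm
  · have ha : ComputableIn {s} fun p : ℕ × List ℕ => p.2 := .snd
    have hn := primrec_list_sum.computableIn.comp ha
    exact ((CEIn.of_decidableIn (decidableIn_forall_mem_dom hR ha)).and
      ((CEIn.of_rePred 𝕂.neg_ce).comp ((computableIn_index hR hn).pair
        (ComputableIn.fst.pair (computableIn_map_pick hR hn ha))))).of_iff
      fun p => mem_negDiagram_iff.symm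
  · have ha : ComputableIn {s} fun p : ℕ × (List ℕ × ℕ) => p.2.1 :=
      (Primrec.fst.comp .snd).computableIn
    have hb : ComputableIn {s} fun p : ℕ × (List ℕ × ℕ) => p.2.2 :=
      (Primrec.snd.comp .snd).computableIn
    have hba := Primrec.list_cons.computableIn₂.comp (hb.pair ha)
    have hn := primrec_list_sum.computableIn.comp hba
    exact ((CEIn.of_decidableIn (decidableIn_forall_mem_dom hR hba)).and
      ((CEIn.of_rePred 𝕂.fun_ce).comp ((computableIn_index hR hn).pair
        (ComputableIn.fst.pair ((computableIn_map_pick hR hn ha).pair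
          (primrec₂_pick.computableIn₂.comp ((computableIn_word hR hn).pair hb))))))).of_iff
      fun p => mem_funGraph_iff.symm

end RichSequence

end ComputableAge

/-! ### Indices of oracle programs -/

namespace OracleCode

/-- A program for the constant function with value `n`. -/
def const : ℕ → OracleCode
  | 0 => zero
  | n + 1 => comp succ (const n)

/-- A program for `x ↦ c (n, x)`. -/
def curry (c : OracleCode) (n : ℕ) : OracleCode := comp c (pair (const n) (pair left right))

theorem eval_const (s : ℕ →. ℕ) (n x : ℕ) : eval s (const n) x = Part.some n := by
  induction n with
  | zero => rfl
  | succ n ih => simp [const, eval, ih]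

/-- The subprogram `pair left right` is the identity: it splits its input and pairs it again. -/
theorem eval_curry (s : ℕ →. ℕ) (c : OracleCode) (n x : ℕ) :
    eval s (curry c n) x = eval s c (Nat.pair n x) := by
  simp [curry, eval, eval_const, Seq.seq]
  exact Part.bind_some _ _

theorem primrec_index_const : Primrec fun n => (const n).index :=
  -- Here 1 is the index of `succ`, and 6 is the offset of `comp` in `index`.
  (Primrec.nat_rec₁ 0 (f := fun _ i => 4 * Nat.pair 1 i + 6) (Primrec.nat_add.comp
    (Primrec.nat_mul.comp (.const 4) (Primrec₂.natPair.comp (.const 1) .snd)) (.const 6))).of_eq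
    fun n => by induction n <;> simp_all [const, index]

theorem primrec_index_curry (c : OracleCode) : Primrec fun n => (c.curry n).index :=
  Primrec.nat_add.comp (Primrec.nat_mul.comp (.const 4) (Primrec₂.natPair.comp (.const _)
    (Primrec.nat_add.comp (Primrec.nat_mul.comp (.const 4)
      (Primrec₂.natPair.comp primrec_index_const (.const _))) (.const 5)))) (.const 6)

/-- The `s-m-n` theorem relative to an oracle. -/
theorem exists_primrec_index {α : Type*} [Primcodable α] {s : ℕ →. ℕ} {F : α × ℕ →. ℕ}
    (hF : RecursiveIn {s} F) : ∃ g : α → ℕ, Primrec g ∧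
      ∀ a, ∃ c : OracleCode, c.index = g a ∧ ∀ x, c.eval s x = F (a, x) := by
  obtain ⟨c, hc⟩ := (exists_eval_iff s _).2 hF
  refine ⟨fun a => (c.curry (Encodable.encode a)).index,
    (primrec_index_curry c).comp .encode, fun a => ⟨_, rfl, fun x => ?_⟩⟩
  rw [eval_curry, hc]
  simp [Part.map_id']

end OracleCode

/-! ### Computable ultrahomogeneity from computable one-point extensions -/

theorem List.lookup_eq_some_iff_mem {α β : Type*} [DecidableEq α] {l : List (α × β)}
    (h : ∀ x y y', (x, y) ∈ l → (x, y') ∈ l → y = y') {x : α} {y : β} :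
    l.lookup x = some y ↔ (x, y) ∈ l := by
  induction l with
  | nil => simp
  | cons q l ih =>
    obtain ⟨a, b⟩ := q
    rw [List.lookup_cons]
    by_cases hx : x = a
    · subst hx
      simp only [beq_self_eq_true, Option.some.injEq]
      exact ⟨fun hb => hb ▸ List.mem_cons_self, fun hm => h x _ _ List.mem_cons_self hm⟩
    · rw [beq_false_of_ne hx]
      simp only [List.mem_cons, Prod.mk.injEq, hx, false_and, false_or]
      exact ih fun x y y' h1 h2 => h x y y' (List.mem_cons_of_mem _ h1) (List.mem_cons_of_mem _ h2)

/-- The list of pairs of entries of two lists at the same position. -/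
def pairUp (a b : List ℕ) : List (ℕ × ℕ) :=
  (List.range a.length).map fun i => (a.getD i 0, b.getD i 0)

theorem map_fst_pairUp (a b : List ℕ) : (pairUp a b).map Prod.fst = a := by
  apply List.ext_getElem <;> simp +contextual [pairUp]

theorem map_snd_pairUp {a b : List ℕ} (h : a.length = b.length) :
    (pairUp a b).map Prod.snd = b := by
  apply List.ext_getElem <;> simp +contextual [pairUp, h]

theorem primrec₂_pairUp : Primrec₂ pairUp :=
  Primrec.list_map (Primrec.list_range.comp (Primrec.list_length.comp .fst))
    (((Primrec.list_getD 0).comp (Primrec.fst.comp .fst) .snd).pair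
      ((Primrec.list_getD 0).comp (Primrec.snd.comp .fst) .snd))

namespace NatStructure

variable {L : FirstOrder.Language.{u, v}} {M : NatStructure L} {s : ℕ →. ℕ}

theorem isUltrahomogeneous_of_computably (h : IsComputablyUltrahomogeneousIn s M) :
    L.IsUltrahomogeneous M.dom := by
  obtain ⟨g, -, hg⟩ := h
  refine isUltrahomogeneous_of_sameAtomicType fun n a b hab => ?_
  obtain ⟨e, σ, -, -, h⟩ := hg n a b
  obtain ⟨⟨α, hα⟩, hσ⟩ := h hab
  exact ⟨α, fun k => (hα _).trans (Subtype.ext (congrArg Subtype.val (hσ k)))⟩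

/-- Extend a finite partial map by a value at `x`. -/
def forth (ext : (List ℕ × List ℕ) × ℕ → ℕ) (l : List (ℕ × ℕ)) (x : ℕ) : List (ℕ × ℕ) :=
  (x, ext ((l.map Prod.fst, l.map Prod.snd), x)) :: l

/-- Extend a finite partial map by a preimage of `x`. -/
def back (ext : (List ℕ × List ℕ) × ℕ → ℕ) (l : List (ℕ × ℕ)) (x : ℕ) : List (ℕ × ℕ) :=
  (ext ((l.map Prod.snd, l.map Prod.fst), x), x) :: l

open Classical in
/-- The finite partial isomorphism that `backAndForth` starts from. -/
noncomputable def initialMap (M : NatStructure L) (p : List ℕ × List ℕ) : List (ℕ × ℕ) :=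
  if Sim M M p.1 p.2 then pairUp p.1 p.2 else []

open Classical in
/-- Add `x` to the domain and to the range of a finite partial map, if it belongs to `M`. -/
noncomputable def backAndForthStep (M : NatStructure L) (ext : (List ℕ × List ℕ) × ℕ → ℕ)
    (l : List (ℕ × ℕ)) (x : ℕ) : List (ℕ × ℕ) :=
  if x ∈ M.dom then back ext (forth ext l x) x else l

/-- The sequence of finite partial maps of a back-and-forth construction. -/
noncomputable def backAndForth (M : NatStructure L) (ext : (List ℕ × List ℕ) × ℕ → ℕ)
    (p : List ℕ × List ℕ) (n : ℕ) : List (ℕ × ℕ) :=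
  Nat.rec (motive := fun _ => List (ℕ × ℕ)) (initialMap M p)
    (fun m l => backAndForthStep M ext l m) n

section Computability

variable {ext : (List ℕ × List ℕ) × ℕ → ℕ} (hextc : ComputableIn {s} ext)
  (hdom : DecidableIn s fun x => x ∈ M.dom)
  (hsim : DecidableIn s fun p : List ℕ × List ℕ => Sim M M p.1 p.2)

theorem primrec_map_fst : Primrec fun q : List (ℕ × ℕ) × ℕ => q.1.map Prod.fst :=
  Primrec.list_map .fst (Primrec.fst.comp .snd)

theorem primrec_map_snd : Primrec fun q : List (ℕ × ℕ) × ℕ => q.1.map Prod.snd :=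
  Primrec.list_map .fst (Primrec.snd.comp .snd)

include hextc

theorem computableIn_forth :
    ComputableIn {s} fun q : List (ℕ × ℕ) × ℕ => forth ext q.1 q.2 :=
  Primrec.list_cons.computableIn₂.comp ((ComputableIn.snd.pair (hextc.comp
    ((primrec_map_fst.pair primrec_map_snd).pair .snd).computableIn)).pair .fst)

theorem computableIn_back :
    ComputableIn {s} fun q : List (ℕ × ℕ) × ℕ => back ext q.1 q.2 :=
  Primrec.list_cons.computableIn₂.comp (((hextc.comp
    ((primrec_map_snd.pair primrec_map_fst).pair .snd).computableIn).pair .snd).pair .fst)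

include hdom

theorem computableIn_backAndForthStep :
    ComputableIn {s} fun q : List (ℕ × ℕ) × ℕ => backAndForthStep M ext q.1 q.2 :=
  (hdom.comp .snd).ite ((computableIn_back hextc).comp ((computableIn_forth hextc).pair .snd)) .fst

include hsim

theorem computableIn_backAndForth :
    ComputableIn {s} fun q : (List ℕ × List ℕ) × ℕ => backAndForth M ext q.1 q.2 := by
  have hinit : ComputableIn {s} (initialMap M) := by
    have h : ComputableIn {s} fun p : List ℕ × List ℕ => pairUp p.1 p.2 :=
      primrec₂_pairUp.computableIn₂
    exact hsim.ite h (.const [])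
  have hproj : ComputableIn {s}
      fun q : ((List ℕ × List ℕ) × ℕ) × (ℕ × List (ℕ × ℕ)) => (q.2.2, q.2.1) :=
    ((Primrec.snd.comp .snd).pair (Primrec.fst.comp .snd)).computableIn
  have h1 := hinit.comp (ComputableIn.fst (α := List ℕ × List ℕ) (β := ℕ))
  have h2 := (computableIn_backAndForthStep hextc hdom).comp hproj
  have h3 := ComputableIn.nat_rec (ComputableIn.snd (α := List ℕ × List ℕ) (β := ℕ)) h1 h2
  exact h3

/-- This is the partial function whose index will be returned: wait until `x` enters the domain of
the growing finite map. It diverges if `x` never does, as the exact-graph requirement on indices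
demands. -/
theorem recursiveIn_lookup_backAndForth :
    RecursiveIn {s} fun q : (List ℕ × List ℕ) × ℕ =>
      Nat.rfindOpt fun n => (backAndForth M ext q.1 n).lookup q.2 := by
  have hproj : ComputableIn {s} fun q : ((List ℕ × List ℕ) × ℕ) × ℕ => (q.1.1, q.2) :=
    ((Primrec.fst.comp .fst).pair .snd).computableIn
  have hx : ComputableIn {s} fun q : ((List ℕ × List ℕ) × ℕ) × ℕ => q.1.2 :=
    (Primrec.snd.comp .fst).computableIn
  have h1 := (computableIn_backAndForth hextc hdom hsim).comp hproj
  have h2 := hx.pair h1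
  have hlookup : ComputableIn {s} fun q : ℕ × List (ℕ × ℕ) => q.2.lookup q.1 :=
    Primrec.listLookup.computableIn₂
  have h3 := RecursiveIn.rfindOpt (hlookup.comp h2)
  exact h3

end Computability

section Correctness

variable {ext : (List ℕ × List ℕ) × ℕ → ℕ} (p : List ℕ × List ℕ)

theorem backAndForth_succ {n : ℕ} (h : n ∈ M.dom) : backAndForth M ext p (n + 1) =
    back ext (forth ext (backAndForth M ext p n) n) n :=
  if_pos h

theorem backAndForth_succ_of_notMem {n : ℕ} (h : n ∉ M.dom) :
    backAndForth M ext p (n + 1) = backAndForth M ext p n :=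
  if_neg h

theorem backAndForth_subset_succ (n : ℕ) :
    backAndForth M ext p n ⊆ backAndForth M ext p (n + 1) := by
  by_cases h : n ∈ M.dom
  · rw [backAndForth_succ p h]
    exact fun x hx => List.mem_cons_of_mem _ (List.mem_cons_of_mem _ hx)
  · rw [backAndForth_succ_of_notMem p h]
    exact List.Subset.refl _

theorem backAndForth_mono {m n : ℕ} (h : m ≤ n) :
    backAndForth M ext p m ⊆ backAndForth M ext p n := by
  induction n, h using Nat.le_induction with
  | base => exact List.Subset.refl _
  | succ n _ ih => exact List.Subset.trans ih (backAndForth_subset_succ p n)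

variable (hext : ∀ (q : List ℕ × List ℕ) (x : ℕ), Sim M M q.1 q.2 → x ∈ M.dom →
  Sim M M (x :: q.1) (ext (q, x) :: q.2))
include hext

theorem sim_backAndForth (n : ℕ) : Sim M M ((backAndForth M ext p n).map Prod.fst)
    ((backAndForth M ext p n).map Prod.snd) := by
  induction n with
  | zero =>
    change Sim M M ((initialMap M p).map Prod.fst) ((initialMap M p).map Prod.snd)
    by_cases h : Sim M M p.1 p.2
    · rwa [initialMap, if_pos h, map_fst_pairUp, map_snd_pairUp h.length_eq]
    -- For dissimilar tuples the construction starts from the empty map, so a bijection results in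
    -- every case.
    · rw [initialMap, if_neg h]
      exact Sim.refl (by simp)
  | succ n ih =>
    by_cases h : n ∈ M.dom
    · rw [backAndForth_succ p h]
      have h1 : Sim M M ((forth ext (backAndForth M ext p n) n).map Prod.fst)
          ((forth ext (backAndForth M ext p n) n).map Prod.snd) := hext (_, _) n ih h
      -- Going back is going forth for the inverse map.
      exact (hext (_, _) n h1.symm h).symm
    · rwa [backAndForth_succ_of_notMem p h]

theorem backAndForth_functional (n x y y' : ℕ) (h : (x, y) ∈ backAndForth M ext p n)
    (h' : (x, y') ∈ backAndForth M ext p n) : y = y' := by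
  have hQ := sim_backAndForth p hext n
  have hd : ∀ {z}, (x, z) ∈ backAndForth M ext p n → x ∈ M.dom ∧ z ∈ M.dom := fun hz =>
    ⟨hQ.mem_dom (List.mem_map.2 ⟨_, hz, rfl⟩), hQ.symm.mem_dom (List.mem_map.2 ⟨_, hz, rfl⟩)⟩
  have := (hQ.sameType_of_mem (ι := Bool) (v := fun _ => ⟨x, (hd h).1⟩)
    (w := fun i => bif i then ⟨y, (hd h).2⟩ else ⟨y', (hd h').2⟩)
    (Bool.forall_bool.2 ⟨h', h⟩)).apply_eq_iff true false
  exact congrArg Subtype.val (this.1 rfl)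

theorem mem_rfindOpt_lookup_iff {x y : ℕ} :
    (y ∈ Nat.rfindOpt fun n => (backAndForth M ext p n).lookup x) ↔
      ∃ n, (x, y) ∈ backAndForth M ext p n := by
  have key : ∀ m {y}, (backAndForth M ext p m).lookup x = some y ↔
      (x, y) ∈ backAndForth M ext p m := fun m {y} =>
    List.lookup_eq_some_iff_mem (backAndForth_functional p hext m)
  rw [Nat.rfindOpt_mono]
  · exact exists_congr fun m => key m
  · exact fun {y m n} hmn h => (key n).2 (backAndForth_mono _ hmn ((key m).1 h))

end Correctness

/-- Decidable similarity makes one-point extensions computable by search; back-and-forth along the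
natural numbers then yields the automorphism, uniformly in the two tuples, and `s-m-n` its index. -/
theorem isComputablyUltrahomogeneousIn_of_extension (hdom : DecidableIn s fun x => x ∈ M.dom)
    (hsim : DecidableIn s fun p : List ℕ × List ℕ => Sim M M p.1 p.2)
    (hext : ∀ (a b : List ℕ) (x : ℕ), Sim M M a b → x ∈ M.dom → ∃ y, Sim M M (x :: a) (y :: b)) :
    IsComputablyUltrahomogeneousIn s M := by
  have hr : DecidableIn s fun q : ((List ℕ × List ℕ) × ℕ) × ℕ => Sim M M q.1.1.1 q.1.1.2 →
      q.1.2 ∈ M.dom → Sim M M (q.1.2 :: q.1.1.1) (q.2 :: q.1.1.2) := by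
    have p : Primrec fun q : ((List ℕ × List ℕ) × ℕ) × ℕ => q.1.1 := Primrec.fst.comp .fst
    have x : Primrec fun q : ((List ℕ × List ℕ) × ℕ) × ℕ => q.1.2 := Primrec.snd.comp .fst
    exact (hsim.comp p.computableIn).imp ((hdom.comp x.computableIn).imp (hsim.comp
      ((Primrec.list_cons.comp x (Primrec.fst.comp p)).pair
        (Primrec.list_cons.comp .snd (Primrec.snd.comp p))).computableIn))
  obtain ⟨ext, hextc, hext'⟩ := hr.exists_selector fun q => by
    by_cases h : Sim M M q.1.1 q.1.2 ∧ q.2 ∈ M.dom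
    · obtain ⟨y, hy⟩ := hext _ _ _ h.1 h.2
      exact ⟨y, fun _ _ => hy⟩
    · exact ⟨0, fun h1 h2 => (h ⟨h1, h2⟩).elim⟩
  replace hext' : ∀ (q : List ℕ × List ℕ) (x : ℕ), Sim M M q.1 q.2 → x ∈ M.dom →
      Sim M M (x :: q.1) (ext (q, x) :: q.2) := fun q x => hext' (q, x)
  obtain ⟨g, hg, hgc⟩ :=
    OracleCode.exists_primrec_index (recursiveIn_lookup_backAndForth hextc hdom hsim)
  refine ⟨fun p => Part.some (g p), hg.computableIn, fun n a b => ?_⟩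
  generalize hp : (List.ofFn fun k => (a k : ℕ), List.ofFn fun k => (b k : ℕ)) = p
  obtain ⟨σ, hσ, hα⟩ := exists_automorphism (sim_backAndForth p hext')
    (backAndForth_subset_succ p)
    -- Step `x` treats the element `x`: the pair with `x` on the right comes first in the new list,
    -- the pair with `x` on the left second.
    (fun x hx => ⟨x + 1, _, by
      rw [backAndForth_succ p hx]; exact List.mem_cons_of_mem _ List.mem_cons_self⟩)
    (fun x hx => ⟨x + 1, _, by rw [backAndForth_succ p hx]; exact List.mem_cons_self⟩)
  refine ⟨_, σ, Part.mem_some _, ?_, fun hab => ⟨hα, fun k => ?_⟩⟩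
  · obtain ⟨c, hc, he⟩ := hgc p
    exact ⟨c, hc, fun x y => by rw [he, ← hσ]; exact mem_rfindOpt_lookup_iff p hext'⟩
  · have hs : Sim M M p.1 p.2 := by
      subst hp
      exact sim_ofFn_iff.2 (sameAtomicType_iff.1 hab)
    obtain ⟨h, hk⟩ := (hσ (a k) (b k)).1 ⟨0, by
      change _ ∈ initialMap M p
      rw [initialMap, if_pos hs, ← hp]
      simp only [pairUp, List.mem_map, List.mem_range, List.length_ofFn]
      exact ⟨k, k.2, by simp⟩⟩
    exact Subtype.ext hk

end NatStructure

/-! ### Computable enumerations -/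

theorem REPred.exists_primrec_stages {α : Type*} [Primcodable α] {p : α → Prop} (hp : REPred p) :
    ∃ D : α → ℕ → Bool, Primrec₂ D ∧ (∀ a, p a ↔ ∃ t, D a t = true) ∧
      ∀ a t t', t ≤ t' → D a t = true → D a t' = true := by
  obtain ⟨c, hc⟩ := Nat.Partrec.Code.exists_code.1 hp
  refine ⟨fun a t => (c.evaln t (Encodable.encode a)).isSome,
    Primrec.option_isSome.comp (Nat.Partrec.Code.primrec_evaln.comp
      ((Primrec.snd.pair (.const c)).pair (Primrec.encode.comp .fst))), fun a => ?_,
    fun a t t' h ha => ?_⟩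
  · have h1 : p a ↔ ∃ x, x ∈ c.eval (Encodable.encode a) := by
      rw [hc]; simp
    simp only [h1, Nat.Partrec.Code.evaln_complete, Option.isSome_iff_exists, Option.mem_def]
    exact exists_comm
  · obtain ⟨x, hx⟩ := Option.isSome_iff_exists.1 ha
    exact Option.isSome_iff_exists.2 ⟨x, Nat.Partrec.Code.evaln_mono h hx⟩

/-- A nowhere defined oracle gives no information, so the closure properties of `DecidableIn` can be
used for unrelativized statements. -/
theorem REPred.exists_of_decidableIn {α : Type} [Primcodable α] {p : α × ℕ → Prop}
    (hp : DecidableIn (fun _ => Part.none) p) : REPred fun a => ∃ k, p (a, k) := by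
  obtain ⟨f, hf, h⟩ := DecidableIn.iff_bool.1 hp
  have h1 := (RecursiveIn.rfind (p := fun q => Part.some (f q)) hf).partrec_of_const
  refine h1.dom_re.of_eq fun a => ?_
  refine Nat.rfind_dom.trans ?_
  simp [← h]

theorem charFun_le_haltingSet {α : Type} [Denumerable α] {A : Set α} (hA : REPred fun a => a ∉ A) :
    charFun A ≤ᵀ charFun haltingSet := by
  classical
  -- Every number codes an element of `α`, so this program halts on exactly the codes of elements
  -- outside `A`.
  obtain ⟨c, hc⟩ := Nat.Partrec.Code.exists_code.1
    (Partrec.nat_iff.1 ((Partrec.comp hA (Computable.ofNat α)).map (Computable.const 0).to₂))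
  have h1 : DecidableIn (charFun haltingSet) fun n : ℕ => (c, n) ∈ haltingSet :=
    (charFun_decidableIn .rfl).comp ((Primrec.const c).pair .id).computableIn
  have h2 := h1.ite (.const 0) (.const 1)
  refine RecursiveIn.of_eq h2 fun n => ?_
  have h3 : (c, n) ∈ haltingSet ↔ ¬ ∃ a ∈ A, Encodable.encode a = n := by
    rw [haltingSet, Set.mem_ofPred_eq, hc]
    simp only [Part.map_Dom]
    have : (∃ a ∈ A, Encodable.encode a = n) ↔ Denumerable.ofNat α n ∈ A :=
      ⟨fun ⟨a, ha, h⟩ => by rwa [← h, Denumerable.ofNat_encode], fun h => ⟨_, h, by simp⟩⟩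
    rw [this]
    simp [Part.assert]
  by_cases h : ∃ a ∈ A, Encodable.encode a = n
  · simp [charFun, h3, h]
  · simp [charFun, h3, h]

/-- The entries of `l` at the valid positions in `p`. -/
def entries {α : Type*} (l : List α) (p : List ℕ) : List α := p.filterMap fun i => l[i]?

theorem entries_subset {α : Type*} (l : List α) (p : List ℕ) : entries l p ⊆ l := fun x hx => by
  obtain ⟨i, -, hi⟩ := List.mem_filterMap.1 hx
  exact List.mem_of_getElem? hi

/-- Positions keep their meaning when the list grows at its end, so a task that names its arguments
by position stays valid at all later stages. -/
theorem exists_entries_eq {α : Type*} {l a : List α} (h : a ⊆ l) :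
    ∃ p, ∀ l', l <+: l' → entries l' p = a := by
  induction a with
  | nil => exact ⟨[], fun l' _ => rfl⟩
  | cons x a ih =>
    obtain ⟨p, hp⟩ := ih fun y hy => h (List.mem_cons_of_mem _ hy)
    obtain ⟨i, hi, hx⟩ := List.getElem_of_mem (h List.mem_cons_self)
    refine ⟨i :: p, fun l' hl => ?_⟩
    have : l'[i]? = some x := by
      obtain ⟨t, rfl⟩ := hl
      rw [List.getElem?_append_left hi, List.getElem?_eq_getElem hi, hx]
    rw [entries, List.filterMap_cons_some this]
    exact congrArg _ (hp l' hl)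

theorem primrec₂_entries {α : Type*} [Primcodable α] :
    Primrec₂ (entries : List α → List ℕ → List α) :=
  Primrec.listFilterMap .snd (Primrec.list_getElem?.comp (Primrec.fst.comp .fst) .snd)

/-! ### Dissimilar tuples are computably enumerable -/

namespace NatStructure

open FirstOrder.Language.Structure

variable {L : FirstOrder.Language.{u, v}} {ρ : ComputableLanguage L} {A B : NatStructure L}

theorem mem_funGraph {k : ℕ} (F : L.Functions k) (a : Fin k → A.dom) :
    ((ρ.func.symm ⟨k, F⟩ : ℕ), List.ofFn (fun j => (a j : ℕ)), (funMap F a : A.dom).1) ∈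
      A.funGraph ρ := by
  refine ⟨(ρ.func.symm ⟨k, F⟩).2, ?_⟩
  have h : ρ.func ⟨(ρ.func.symm ⟨k, F⟩ : ℕ), (ρ.func.symm ⟨k, F⟩).2⟩ = ⟨k, F⟩ :=
    ρ.func.apply_symm_apply _
  -- The symbol is made a variable so that its arity, on which the types depend, can be substituted.
  generalize ρ.func _ = q at h
  subst h
  exact ⟨a, rfl, rfl⟩

theorem mem_posDiagram {k : ℕ} {r : L.Relations k} {a : Fin k → A.dom} (hr : RelMap r a) :
    ((ρ.rel.symm ⟨k, r⟩ : ℕ), List.ofFn (fun j => (a j : ℕ))) ∈ A.posDiagram ρ := by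
  refine ⟨(ρ.rel.symm ⟨k, r⟩).2, ?_⟩
  have h : ρ.rel ⟨(ρ.rel.symm ⟨k, r⟩ : ℕ), (ρ.rel.symm ⟨k, r⟩).2⟩ = ⟨k, r⟩ :=
    ρ.rel.apply_symm_apply _
  generalize ρ.rel _ = q at h
  subst h
  exact ⟨a, rfl, hr⟩

theorem mem_negDiagram {k : ℕ} {r : L.Relations k} {a : Fin k → A.dom} (hr : ¬ RelMap r a) :
    ((ρ.rel.symm ⟨k, r⟩ : ℕ), List.ofFn (fun j => (a j : ℕ))) ∈ A.negDiagram ρ := by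
  refine ⟨(ρ.rel.symm ⟨k, r⟩).2, ?_⟩
  have h : ρ.rel ⟨(ρ.rel.symm ⟨k, r⟩ : ℕ), (ρ.rel.symm ⟨k, r⟩).2⟩ = ⟨k, r⟩ :=
    ρ.rel.apply_symm_apply _
  generalize ρ.rel _ = q at h
  subst h
  exact ⟨a, rfl, hr⟩

/-- The point is that one family of terms gives both argument tuples, so a function or relation
symbol applied to it is evaluated at `b` and `c` simultaneously. -/
theorem exists_realize_of_mem {n k : ℕ} {b : Fin n → A.dom} {c : Fin n → B.dom}
    {l : List (ℕ × ℕ)} (hl : ∀ q ∈ l, ∃ t : L.Term (Fin n),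
      q = ((t.realize b : A.dom).1, (t.realize c : B.dom).1))
    {x : Fin k → A.dom} {y : Fin k → B.dom}
    (hx : l.map Prod.fst = List.ofFn fun j => (x j : ℕ))
    (hy : l.map Prod.snd = List.ofFn fun j => (y j : ℕ)) :
    ∃ t : Fin k → L.Term (Fin n), (∀ j, (t j).realize b = x j) ∧ ∀ j, (t j).realize c = y j := by
  have hk : l.length = k := by simpa using congrArg List.length hx
  subst hk
  have key : ∀ j : Fin l.length, l[j] = ((x j : ℕ), (y j : ℕ)) := fun j => by
    have h1 := List.getElem_of_eq hx (i := j) (by simp)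
    have h2 := List.getElem_of_eq hy (i := j) (by simp)
    simp only [List.getElem_map, List.getElem_ofFn] at h1 h2
    exact Prod.ext h1 h2
  choose t ht using fun j : Fin l.length => hl l[j] (List.getElem_mem _)
  refine ⟨t, fun j => Subtype.ext ?_, fun j => Subtype.ext ?_⟩
  · exact (congrArg Prod.fst ((ht j).symm.trans (key j)))
  · exact (congrArg Prod.snd ((ht j).symm.trans (key j)))

end NatStructure

/-- A pair of tuples in two structures of an age. -/
abbrev TuplePair := (ℕ × List ℕ) × (ℕ × List ℕ)

/-- The name of a function symbol, the positions of its arguments, and a pair of values. -/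
abbrev GenTask := ℕ × (List ℕ × (ℕ × ℕ))

/-- If the task is verified by the enumeration `D` of the function graphs, append the pair of values
to the list of pairs of corresponding elements. -/
def genStep (D : ℕ × (ℕ × List ℕ × ℕ) → ℕ → Bool) (z : TuplePair) (m : ℕ) (t : GenTask)
    (l : List (ℕ × ℕ)) : List (ℕ × ℕ) :=
  bif D (z.1.1, (t.1, (entries l t.2.1).map Prod.fst, t.2.2.1)) m &&
      D (z.2.1, (t.1, (entries l t.2.1).map Prod.snd, t.2.2.2)) m
    then l ++ [t.2.2] else l

/-- An increasing enumeration of the pairs of corresponding elements of the substructures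
generated by two tuples. -/
def gen (D : ℕ × (ℕ × List ℕ × ℕ) → ℕ → Bool) (z : TuplePair) (m : ℕ) : List (ℕ × ℕ) :=
  Nat.rec (motive := fun _ => List (ℕ × ℕ)) (pairUp z.1.2 z.2.2)
    (fun m l => genStep D z m (Denumerable.ofNat GenTask m.unpair.1) l) m

theorem primrec_genStep {D : ℕ × (ℕ × List ℕ × ℕ) → ℕ → Bool} (hD : Primrec₂ D) :
    Primrec fun q : (TuplePair × ℕ) × (GenTask × List (ℕ × ℕ)) =>
      genStep D q.1.1 q.1.2 q.2.1 q.2.2 := by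
  have z : Primrec fun q : (TuplePair × ℕ) × (GenTask × List (ℕ × ℕ)) => q.1.1 :=
    Primrec.fst.comp .fst
  have m : Primrec fun q : (TuplePair × ℕ) × (GenTask × List (ℕ × ℕ)) => q.1.2 :=
    Primrec.snd.comp .fst
  have t : Primrec fun q : (TuplePair × ℕ) × (GenTask × List (ℕ × ℕ)) => q.2.1 :=
    Primrec.fst.comp .snd
  have l : Primrec fun q : (TuplePair × ℕ) × (GenTask × List (ℕ × ℕ)) => q.2.2 :=
    Primrec.snd.comp .snd
  have t1 := Primrec.fst.comp t
  have t2 := Primrec.fst.comp (Primrec.snd.comp t)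
  have xy := Primrec.snd.comp (Primrec.snd.comp t)
  have args := primrec₂_entries.comp l t2
  have a1 := Primrec.list_map args (Primrec.fst.comp Primrec.snd).to₂
  have a2 := Primrec.list_map args (Primrec.snd.comp Primrec.snd).to₂
  have d1 := hD.comp ((Primrec.fst.comp (Primrec.fst.comp z)).pair
    (t1.pair (a1.pair (Primrec.fst.comp xy)))) m
  have d2 := hD.comp ((Primrec.fst.comp (Primrec.snd.comp z)).pair
    (t1.pair (a2.pair (Primrec.snd.comp xy)))) m
  have h := Primrec.cond (Primrec.and.comp d1 d2) (Primrec.list_concat.comp l xy) l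
  exact h

theorem primrec₂_gen {D : ℕ × (ℕ × List ℕ × ℕ) → ℕ → Bool} (hD : Primrec₂ D) :
    Primrec₂ (gen D) := by
  have z : Primrec fun q : (TuplePair × ℕ) × (ℕ × List (ℕ × ℕ)) => q.1.1 := Primrec.fst.comp .fst
  have m : Primrec fun q : (TuplePair × ℕ) × (ℕ × List (ℕ × ℕ)) => q.2.1 := Primrec.fst.comp .snd
  have l : Primrec fun q : (TuplePair × ℕ) × (ℕ × List (ℕ × ℕ)) => q.2.2 := Primrec.snd.comp .snd
  have t := (Primrec.ofNat GenTask).comp (Primrec.fst.comp (Primrec.unpair.comp m))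
  have hs := (primrec_genStep hD).comp ((z.pair m).pair (t.pair l))
  have h0 := primrec₂_pairUp.comp (Primrec.snd.comp (Primrec.fst.comp
    (Primrec.fst (α := TuplePair) (β := ℕ)))) (Primrec.snd.comp (Primrec.snd.comp .fst))
  have h := Primrec.nat_rec' (Primrec.snd (α := TuplePair) (β := ℕ)) h0 hs.to₂
  exact h

theorem gen_prefix_succ (D : ℕ × (ℕ × List ℕ × ℕ) → ℕ → Bool) (z : TuplePair) (m : ℕ) :
    gen D z m <+: gen D z (m + 1) := by
  change gen D z m <+: genStep D z m _ (gen D z m)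
  unfold genStep
  cases _ && _
  · exact List.prefix_rfl
  · exact List.prefix_append _ _

theorem gen_prefix (D : ℕ × (ℕ × List ℕ × ℕ) → ℕ → Bool) (z : TuplePair) {m n : ℕ} (h : m ≤ n) :
    gen D z m <+: gen D z n := by
  induction n, h using Nat.le_induction with
  | base => exact List.prefix_rfl
  | succ n _ ih => exact ih.trans (gen_prefix_succ D z n)

namespace ComputableAge

open NatStructure FirstOrder.Language.Structure

variable {L : FirstOrder.Language.{u, v}} {ρ : ComputableLanguage L}
  {K : Set (Bundled.{0} L.Structure)} {𝕂 : ComputableAge ρ K}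
  {D : ℕ × (ℕ × List ℕ × ℕ) → ℕ → Bool}

theorem exists_realize_of_mem_gen (hD : ∀ q m, D q m = true → q.2 ∈ (𝕂.struct q.1).funGraph ρ)
    {i j n : ℕ} (b : Fin n → (𝕂.struct i).dom) (c : Fin n → (𝕂.struct j).dom) (m : ℕ) :
    ∀ q ∈ gen D ((i, List.ofFn fun k => (b k : ℕ)), (j, List.ofFn fun k => (c k : ℕ))) m,
      ∃ t : L.Term (Fin n), q = ((t.realize b : (𝕂.struct i).dom).1,
        (t.realize c : (𝕂.struct j).dom).1) := by
  induction m with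
  | zero =>
    intro q hq
    obtain ⟨k, hk, rfl⟩ := List.mem_map.1 hq
    simp only [List.mem_range, List.length_ofFn] at hk
    exact ⟨.var ⟨k, hk⟩, by simp [hk]⟩
  | succ m ih =>
    intro q hq
    change q ∈ genStep D _ m _ (gen D _ m) at hq
    unfold genStep at hq
    cases hc : _ && _ <;> rw [hc] at hq
    · exact ih q hq
    · rcases List.mem_append.1 hq with hq | hq
      · exact ih q hq
      · obtain ⟨h1, h2⟩ := Bool.and_eq_true_iff.1 hc
        obtain ⟨hn, x, hx, hxv⟩ := hD _ _ h1
        obtain ⟨_, y, hy, hyv⟩ := hD _ _ h2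
        obtain ⟨t, htb, htc⟩ := exists_realize_of_mem
          (fun q hq => ih q (entries_subset _ _ hq)) hx hy
        refine ⟨.func (ρ.func ⟨_, hn⟩).2 t, (List.mem_singleton.1 hq).trans (Prod.ext ?_ ?_)⟩
        · simp only [Term.realize_func, htb]; exact hxv.symm
        · simp only [Term.realize_func, htc]; exact hyv.symm

/-- Induction on the term: once the pairs of its arguments are listed, a task that guesses both
function values is accepted as soon as the graphs confirm them. -/
theorem exists_mem_gen (hD : ∀ q, q.2 ∈ (𝕂.struct q.1).funGraph ρ → ∃ m, D q m = true)
    (hmono : ∀ q m n, m ≤ n → D q m = true → D q n = true)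
    {i j n : ℕ} (b : Fin n → (𝕂.struct i).dom) (c : Fin n → (𝕂.struct j).dom)
    (t : L.Term (Fin n)) :
    ∃ m, ((t.realize b : (𝕂.struct i).dom).1, (t.realize c : (𝕂.struct j).dom).1) ∈
      gen D ((i, List.ofFn fun k => (b k : ℕ)), (j, List.ofFn fun k => (c k : ℕ))) m := by
  induction t with
  | var k =>
    refine ⟨0, List.mem_map.2 ⟨k, ?_, ?_⟩⟩ <;> simp
  | func F t ih =>
    choose N hN using ih
    obtain ⟨N', hN'⟩ := Finite.exists_le N
    obtain ⟨T1, h1⟩ := hD (i, _) (mem_funGraph (ρ := ρ) F fun k => (t k).realize b)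
    obtain ⟨T2, h2⟩ := hD (j, _) (mem_funGraph (ρ := ρ) F fun k => (t k).realize c)
    obtain ⟨p, hp⟩ := exists_entries_eq (a := List.ofFn fun k =>
      (((t k).realize b : (𝕂.struct i).dom).1, ((t k).realize c : (𝕂.struct j).dom).1))
      (l := gen D ((i, List.ofFn fun k => (b k : ℕ)), (j, List.ofFn fun k => (c k : ℕ))) N')
      fun q hq => by
        obtain ⟨k, rfl⟩ := (List.mem_ofFn' _ _).1 hq
        exact (gen_prefix D _ (hN' k)).subset (hN k)
    let task : GenTask := (ρ.func.symm ⟨_, F⟩, p, ((funMap F fun k => (t k).realize b) :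
      (𝕂.struct i).dom).1, ((funMap F fun k => (t k).realize c) : (𝕂.struct j).dom).1)
    -- Step `m` treats this task when all arguments are listed and both values are confirmed.
    let m := Nat.pair (Encodable.encode task) (N' + T1 + T2)
    have hm : N' + T1 + T2 ≤ m := Nat.right_le_pair _ _
    refine ⟨m + 1, ?_⟩
    change _ ∈ genStep D _ m _ (gen D _ m)
    have htask : Denumerable.ofNat GenTask m.unpair.1 = task := by
      simp only [m, Nat.unpair_pair, Denumerable.ofNat_encode]
    rw [htask]
    unfold genStep
    rw [hp _ (gen_prefix D _ (by omega : N' ≤ m)), List.map_ofFn, List.map_ofFn]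
    have h1' := hmono _ _ m (by omega) h1
    have h2' := hmono _ _ m (by omega) h2
    have hand : (D (i, (task.1, List.ofFn (Prod.fst ∘ fun k =>
        (((t k).realize b : (𝕂.struct i).dom).1, ((t k).realize c : (𝕂.struct j).dom).1)),
          task.2.2.1)) m && D (j, (task.1, List.ofFn (Prod.snd ∘ fun k =>
        (((t k).realize b : (𝕂.struct i).dom).1, ((t k).realize c : (𝕂.struct j).dom).1)),
          task.2.2.2)) m) = true := Bool.and_eq_true_iff.2 ⟨h1', h2'⟩
    dsimp only
    rw [hand]
    exact List.mem_append_right _ (List.mem_singleton.2 rfl)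

end ComputableAge

/-! ### Searching for an atomic formula that separates two tuples -/

namespace ComputableAge

open NatStructure FirstOrder.Language.Structure

variable {L : FirstOrder.Language.{u, v}} {ρ : ComputableLanguage L}
  {K : Set (Bundled.{0} L.Structure)} {𝕂 : ComputableAge ρ K}
  {D : ℕ × (ℕ × List ℕ × ℕ) → ℕ → Bool} {P N : ℕ × (ℕ × List ℕ) → ℕ → Bool}

theorem exists_entries_gen_eq (hD : ∀ q, q.2 ∈ (𝕂.struct q.1).funGraph ρ → ∃ m, D q m = true)
    (hmono : ∀ q m n, m ≤ n → D q m = true → D q n = true)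
    {i j n : ℕ} (b : Fin n → (𝕂.struct i).dom) (c : Fin n → (𝕂.struct j).dom)
    {r : ℕ} (t : Fin r → L.Term (Fin n)) :
    ∃ m p, ∀ m', m ≤ m' →
      entries (gen D ((i, List.ofFn fun k => (b k : ℕ)), (j, List.ofFn fun k => (c k : ℕ))) m') p =
        List.ofFn fun k => (((t k).realize b : (𝕂.struct i).dom).1,
          ((t k).realize c : (𝕂.struct j).dom).1) := by
  choose M hM using fun k => exists_mem_gen hD hmono b c (t k)
  obtain ⟨m, hm⟩ := Finite.exists_le M
  obtain ⟨p, hp⟩ := exists_entries_eq (a := List.ofFn fun k =>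
    (((t k).realize b : (𝕂.struct i).dom).1, ((t k).realize c : (𝕂.struct j).dom).1))
    (l := gen D ((i, List.ofFn fun k => (b k : ℕ)), (j, List.ofFn fun k => (c k : ℕ))) m)
    fun q hq => by
      obtain ⟨k, rfl⟩ := (List.mem_ofFn' _ _).1 hq
      exact (gen_prefix D _ (hm k)).subset (hM k)
  exact ⟨m, p, fun m' h => hp _ (gen_prefix D _ h)⟩

/-- The corresponding elements listed in `args` do not witness that two tuples satisfy distinct
atomic formulas, as far as the enumerations `P` and `N` of the positive and the negative diagrams
of the structures `i` and `j` show by stage `k`. -/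
def Agree (P N : ℕ × (ℕ × List ℕ) → ℕ → Bool) (i j r : ℕ) (args : List (ℕ × ℕ)) (k : ℕ) : Prop :=
  ¬ (P (i, (r, args.map Prod.fst)) k = true ∧ N (j, (r, args.map Prod.snd)) k = true) ∧
  ¬ (N (i, (r, args.map Prod.fst)) k = true ∧ P (j, (r, args.map Prod.snd)) k = true) ∧
  (args.length = 2 →
    (pick (args.map Prod.fst) 0 = pick (args.map Prod.fst) 1 →
      pick (args.map Prod.snd) 0 = pick (args.map Prod.snd) 1) ∧
    (pick (args.map Prod.snd) 0 = pick (args.map Prod.snd) 1 →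
      pick (args.map Prod.fst) 0 = pick (args.map Prod.fst) 1))

/-- At stage `k` no witness has been found that the two tuples do not satisfy the same atomic
formulas. -/
def AgreeAt (D : ℕ × (ℕ × List ℕ × ℕ) → ℕ → Bool) (P N : ℕ × (ℕ × List ℕ) → ℕ → Bool)
    (z : TuplePair) (k : ℕ) : Prop :=
  Agree P N z.1.1 z.2.1 (Denumerable.ofNat (ℕ × List ℕ) k.unpair.1).1
    (entries (gen D z k) (Denumerable.ofNat (ℕ × List ℕ) k.unpair.1).2) k

theorem Agree.of_sameType {i j n : ℕ} {b : Fin n → (𝕂.struct i).dom} {c : Fin n → (𝕂.struct j).dom}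
    (hP : ∀ q m, P q m = true → q.2 ∈ (𝕂.struct q.1).posDiagram ρ)
    (hN : ∀ q m, N q m = true → q.2 ∈ (𝕂.struct q.1).negDiagram ρ) (h : SameType L b c)
    {args : List (ℕ × ℕ)} (ha : ∀ q ∈ args, ∃ t : L.Term (Fin n),
      q = ((t.realize b : (𝕂.struct i).dom).1, (t.realize c : (𝕂.struct j).dom).1)) (r k : ℕ) :
    Agree P N i j r args k := by
  refine ⟨fun ⟨h1, h2⟩ => ?_, fun ⟨h1, h2⟩ => ?_, fun hl => ?_⟩
  · obtain ⟨hr, x, hx, hxr⟩ := hP _ _ h1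
    obtain ⟨_, y, hy, hyr⟩ := hN _ _ h2
    obtain ⟨t, htb, htc⟩ := exists_realize_of_mem ha hx hy
    have := h.rel_iff (ρ.rel ⟨_, hr⟩).2 t
    simp only [htb, htc] at this
    exact hyr (this.1 hxr)
  · obtain ⟨hr, x, hx, hxr⟩ := hN _ _ h1
    obtain ⟨_, y, hy, hyr⟩ := hP _ _ h2
    obtain ⟨t, htb, htc⟩ := exists_realize_of_mem ha hx hy
    have := h.rel_iff (ρ.rel ⟨_, hr⟩).2 t
    simp only [htb, htc] at this
    exact hxr (this.2 hyr)
  · obtain ⟨p, q, rfl⟩ := List.length_eq_two.1 hl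
    obtain ⟨t, rfl⟩ := ha p (by simp)
    obtain ⟨u, rfl⟩ := ha q (by simp)
    have := h.eq_iff t u
    simp only [Subtype.ext_iff] at this
    exact ⟨this.1, this.2⟩

/-- Listed pairs are values of common terms, so tuples of equal type never disagree. Conversely, a
separating atomic formula is exposed at a stage that codes its symbol and the positions of its
arguments and is late enough for the enumerations. -/
theorem sameType_iff_agreeAt (hD : ∀ q, q.2 ∈ (𝕂.struct q.1).funGraph ρ ↔ ∃ m, D q m = true)
    (hD' : ∀ q m n, m ≤ n → D q m = true → D q n = true)
    (hP : ∀ q, q.2 ∈ (𝕂.struct q.1).posDiagram ρ ↔ ∃ m, P q m = true)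
    (hP' : ∀ q m n, m ≤ n → P q m = true → P q n = true)
    (hN : ∀ q, q.2 ∈ (𝕂.struct q.1).negDiagram ρ ↔ ∃ m, N q m = true)
    (hN' : ∀ q m n, m ≤ n → N q m = true → N q n = true)
    {i j n : ℕ} (b : Fin n → (𝕂.struct i).dom) (c : Fin n → (𝕂.struct j).dom) :
    SameType L b c ↔ ∀ k,
      AgreeAt D P N ((i, List.ofFn fun k => (b k : ℕ)), (j, List.ofFn fun k => (c k : ℕ))) k := by
  refine ⟨fun h k => .of_sameType (fun q m hq => (hP q).2 ⟨m, hq⟩)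
    (fun q m hq => (hN q).2 ⟨m, hq⟩) h (fun q hq =>
      exists_realize_of_mem_gen (fun q m hq => (hD q).2 ⟨m, hq⟩) b c k q
        (entries_subset _ _ hq)) _ k, fun h => ?_⟩
  have key : ∀ {r : ℕ} (t : Fin r → L.Term (Fin n)) (s m : ℕ), ∃ k, m ≤ k ∧
      Agree P N i j s (List.ofFn fun l => (((t l).realize b : (𝕂.struct i).dom).1,
          ((t l).realize c : (𝕂.struct j).dom).1)) k := fun t s m => by
    obtain ⟨m', p, hp⟩ := exists_entries_gen_eq (fun q => (hD q).1) hD' b c t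
    have hk := Nat.right_le_pair (Encodable.encode (s, p)) (m + m')
    have hag := h (Nat.pair (Encodable.encode (s, p)) (m + m'))
    simp only [AgreeAt, Nat.unpair_pair, Denumerable.ofNat_encode] at hag
    rw [hp _ (by omega)] at hag
    exact ⟨_, by omega, hag⟩
  constructor
  · intro t u
    -- The name 0 is arbitrary: the clause about equalities does not look at it.
    obtain ⟨k, -, -, -, hk⟩ := key ![t, u] 0 0
    obtain ⟨h1, h2⟩ := hk (by simp)
    exact ⟨fun e => Subtype.ext (h1 (congrArg Subtype.val e)),
      fun e => Subtype.ext (h2 (congrArg Subtype.val e))⟩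
  · intro r R t
    by_contra hne
    rw [not_iff] at hne
    by_cases hb : RelMap R fun l => (t l).realize b
    · obtain ⟨m1, h1⟩ := (hP (i, _)).1 (mem_posDiagram (ρ := ρ) hb)
      obtain ⟨m2, h2⟩ := (hN (j, _)).1 (mem_negDiagram (ρ := ρ) fun hc => hne.2 hc hb)
      obtain ⟨k, hk, hag, -⟩ := key t (ρ.rel.symm ⟨_, R⟩) (m1 + m2)
      rw [List.map_ofFn, List.map_ofFn] at hag
      exact hag ⟨hP' _ _ k (by omega) h1, hN' _ _ k (by omega) h2⟩
    · obtain ⟨m1, h1⟩ := (hN (i, _)).1 (mem_negDiagram (ρ := ρ) hb)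
      obtain ⟨m2, h2⟩ := (hP (j, _)).1 (mem_posDiagram (ρ := ρ) (hne.1 hb))
      obtain ⟨k, hk, -, hag, -⟩ := key t (ρ.rel.symm ⟨_, R⟩) (m1 + m2)
      rw [List.map_ofFn, List.map_ofFn] at hag
      exact hag ⟨hN' _ _ k (by omega) h1, hP' _ _ k (by omega) h2⟩

theorem decidableIn_agreeAt (hD : Primrec₂ D) (hP : Primrec₂ P) (hN : Primrec₂ N) (s : ℕ →. ℕ) :
    DecidableIn s fun q : TuplePair × ℕ => AgreeAt D P N q.1 q.2 := by
  have z : Primrec fun q : TuplePair × ℕ => q.1 := .fst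
  have k : Primrec fun q : TuplePair × ℕ => q.2 := .snd
  have i := Primrec.fst.comp (Primrec.fst.comp z)
  have j := Primrec.fst.comp (Primrec.snd.comp z)
  have task := (Primrec.ofNat (ℕ × List ℕ)).comp (Primrec.fst.comp (Primrec.unpair.comp k))
  have r := Primrec.fst.comp task
  have args := primrec₂_entries.comp ((primrec₂_gen hD).comp z k) (Primrec.snd.comp task)
  have a1 := Primrec.list_map args (Primrec.fst.comp Primrec.snd).to₂
  have a2 := Primrec.list_map args (Primrec.snd.comp Primrec.snd).to₂
  have eq {γ : Type} [Primcodable γ] {f g : TuplePair × ℕ → γ} (hf : Primrec f)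
      (hg : Primrec g) : DecidableIn s fun q => f q = g q :=
    .eq hf.computableIn hg.computableIn
  have p1 := eq (hP.comp (i.pair (r.pair a1)) k) (.const true)
  have n1 := eq (hN.comp (i.pair (r.pair a1)) k) (.const true)
  have p2 := eq (hP.comp (j.pair (r.pair a2)) k) (.const true)
  have n2 := eq (hN.comp (j.pair (r.pair a2)) k) (.const true)
  have l := eq (Primrec.list_length.comp args) (.const 2)
  have e1 := eq (primrec₂_pick.comp a1 (.const 0)) (primrec₂_pick.comp a1 (.const 1))
  have e2 := eq (primrec₂_pick.comp a2 (.const 0)) (primrec₂_pick.comp a2 (.const 1))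
  have h := (p1.and n2).not.and ((n1.and p2).not.and (l.imp ((e1.imp e2).and (e2.imp e1))))
  exact h

theorem rePred_notMem_embedInfo (𝕂 : ComputableAge ρ K) : REPred fun z => z ∉ 𝕂.embedInfo := by
  obtain ⟨D, hD, hD1, hD2⟩ := 𝕂.fun_ce.exists_primrec_stages
  obtain ⟨P, hP, hP1, hP2⟩ := 𝕂.pos_ce.exists_primrec_stages
  obtain ⟨N, hN, hN1, hN2⟩ := 𝕂.neg_ce.exists_primrec_stages
  have z : Primrec fun q : TuplePair × ℕ => q.1 := .fst
  have k : Primrec fun q : TuplePair × ℕ => q.2 := .snd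
  have mem {f : TuplePair × ℕ → ℕ × List ℕ} (hf : Primrec f) :
      DecidableIn (fun _ => Part.none) fun q : TuplePair × ℕ => q.2 < (f q).2.length →
        pick (f q).2 q.2 ∈ (𝕂.struct (f q).1).dom := by
    have hlt : PrimrecPred fun q : TuplePair × ℕ => q.2 < (f q).2.length :=
      Primrec.nat_lt.comp k (Primrec.list_length.comp (Primrec.snd.comp hf))
    have hx := primrec₂_pick.comp (Primrec.snd.comp hf) k
    exact (DecidableIn.of_computablePred hlt.computablePred).imp
      ((DecidableIn.of_computablePred 𝕂.dom_computable).comp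
        ((Primrec.fst.comp hf).pair hx).computableIn)
  have len : DecidableIn (fun _ => Part.none) fun q : TuplePair × ℕ =>
      q.1.1.2.length = q.1.2.2.length :=
    .eq (Primrec.list_length.comp (Primrec.snd.comp (Primrec.fst.comp z))).computableIn
      (Primrec.list_length.comp (Primrec.snd.comp (Primrec.snd.comp z))).computableIn
  -- The searched number is at once a position, at which membership in the domain is checked, and a
  -- stage, at which agreement is checked; one unbounded search thus finds any defect.
  have hre := REPred.exists_of_decidableIn ((mem (Primrec.fst.comp z)).and
    ((mem (Primrec.snd.comp z)).and (len.and (decidableIn_agreeAt hD hP hN _)))).not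
  refine hre.of_eq fun z => ?_
  rw [← not_forall, not_iff_not]
  constructor
  · obtain ⟨⟨i, b⟩, j, d⟩ := z
    intro h
    have hl : b.length = d.length := (h 0).2.2.1
    have hb : ∀ k, (hk : k < b.length) → b[k] ∈ (𝕂.struct i).dom := fun k hk => by
      have := (h k).1 hk
      rwa [pick_of_lt hk] at this
    have hc : ∀ k, (hk : k < b.length) → d[k] ∈ (𝕂.struct j).dom := fun k hk => by
      have := (h k).2.1 (hl ▸ hk)
      rwa [pick_of_lt (hl ▸ hk)] at this
    let b' : Fin b.length → (𝕂.struct i).dom := fun k => ⟨b[k], hb k k.2⟩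
    let c' : Fin b.length → (𝕂.struct j).dom := fun k => ⟨d[k], hc k k.2⟩
    have hb' : b = List.ofFn fun k => (b' k : ℕ) := by
      apply List.ext_getElem <;> simp [b']
    have hc' : d = List.ofFn fun k => (c' k : ℕ) := by
      apply List.ext_getElem <;> simp [c', hl]
    refine ⟨_, b', c', hb', hc', sameAtomicType_iff.2
      ((sameType_iff_agreeAt hD1 hD2 hP1 hP2 hN1 hN2 b' c').2 fun k => ?_)⟩
    rw [← hb', ← hc']
    exact (h k).2.2.2
  · rintro ⟨n, b, c, hb, hc, h⟩ k
    obtain ⟨⟨i, b₀⟩, j, c₀⟩ := z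
    dsimp only at b c hb hc
    subst hb hc
    refine ⟨fun hk => ?_, fun hk => ?_, by simp,
      (sameType_iff_agreeAt hD1 hD2 hP1 hP2 hN1 hN2 b c).1 (sameAtomicType_iff.1 h) k⟩
    · rw [pick_of_lt hk, List.getElem_ofFn]; exact Subtype.prop _
    · rw [pick_of_lt hk, List.getElem_ofFn]; exact Subtype.prop _

theorem charFun_embedInfo_le_haltingSet (𝕂 : ComputableAge ρ K) :
    charFun 𝕂.embedInfo ≤ᵀ charFun haltingSet :=
  charFun_le_haltingSet 𝕂.rePred_notMem_embedInfo

end ComputableAge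

/-! ### The main theorem -/

namespace ComputableAge

open NatStructure FirstOrder.Language.Structure FirstOrder.Language.Substructure

variable {L : FirstOrder.Language.{u, v}} {ρ : ComputableLanguage L}
  {K : Set (Bundled.{0} L.Structure)} {𝕂 : ComputableAge ρ K} {s : ℕ →. ℕ}

theorem RichSequence.isFraisseLimitComputableIn_limit (R : 𝕂.RichSequence) (hK : IsAge K)
    (hHP : Hereditary K) (hJEP : JointEmbedding K)
    (hR : ComputableIn {s} fun n => (R.index n, R.word n)) (hE : charFun 𝕂.embedInfo ≤ᵀ s) :
    IsFraisseLimitComputableIn ρ K s R.limit := by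
  have h := isComputablyUltrahomogeneousIn_of_extension (decidableIn_mem_dom hR)
    (decidableIn_sim_limit hR hE) fun a b x => R.exists_sim_limit_cons
  exact ⟨isComputableIn_limit hR, R.age_limit hK hHP hJEP,
    isUltrahomogeneous_of_computably h, h⟩

/-- The empty tuple generates an empty structure, and by joint embedding its type is the same in all
of them, so any two embed into each other. -/
theorem age_struct_of_isEmpty (hK : IsAge K) (hHP : Hereditary K) (hJEP : JointEmbedding K)
    (he : ∀ i, IsEmpty (𝕂.struct i).dom) (i : ℕ) : L.age (𝕂.struct i).dom = K := by
  ext N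
  refine ⟨fun hN => hHP _ (𝕂.mem_age i) hN, fun hN => ⟨hK.fg N hN, ?_⟩⟩
  obtain ⟨j, ⟨e⟩⟩ := 𝕂.exhausts N hN
  have h : SameType L (Fin.elim0 : Fin 0 → (𝕂.struct j).dom)
      (Fin.elim0 : Fin 0 → (𝕂.struct i).dom) := by
    refine sim_ofFn_iff.1 ?_
    simpa using 𝕂.sim_nil hJEP j i
  obtain ⟨g, -⟩ := h.exists_embedding_of_closure_eq_top
    (Substructure.ext fun x => (he j).elim x)
  exact ⟨g.comp e.toEmbedding⟩

theorem isFraisseLimitComputableIn_struct_of_isEmpty (hK : IsAge K) (hHP : Hereditary K)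
    (hJEP : JointEmbedding K) (he : ∀ i, IsEmpty (𝕂.struct i).dom)
    (hE : charFun 𝕂.embedInfo ≤ᵀ s) (i : ℕ) :
    IsFraisseLimitComputableIn ρ K s (𝕂.struct i) := by
  have hdom : DecidableIn s fun x => x ∈ (𝕂.struct i).dom :=
    (DecidableIn.of_computablePred 𝕂.dom_computable).comp ((ComputableIn.const i).pair .id)
  have h := isComputablyUltrahomogeneousIn_of_extension hdom
    (decidableIn_sim hE ((ComputableIn.const i).pair .fst) ((ComputableIn.const i).pair .snd))
    fun a b x _ hx => ((he i).false ⟨x, hx⟩).elim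
  exact ⟨⟨hdom, (CEIn.of_rePred 𝕂.pos_ce).comp ((ComputableIn.const i).pair .id),
    (CEIn.of_rePred 𝕂.neg_ce).comp ((ComputableIn.const i).pair .id),
    (CEIn.of_rePred 𝕂.fun_ce).comp ((ComputableIn.const i).pair .id)⟩,
    age_struct_of_isEmpty hK hHP hJEP he i, isUltrahomogeneous_of_computably h, h⟩

/-- The structure is chosen before the oracle: the rich sequence is computable in the embedding
information, hence in every `s` above it. -/
theorem exists_isFraisseLimitComputableIn (𝕂 : ComputableAge ρ K) (hK : IsAge K)
    (hHP : Hereditary K) (hJEP : JointEmbedding K) (hAP : Amalgamation K) :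
    ∃ M : NatStructure L, ∀ s, charFun 𝕂.embedInfo ≤ᵀ s → IsFraisseLimitComputableIn ρ K s M := by
  by_cases hne : ∃ i, (𝕂.struct i).dom.Nonempty
  · obtain ⟨R, hR⟩ := exists_computable_richSequence hHP hAP hne
    exact ⟨R.limit, fun s hs => R.isFraisseLimitComputableIn_limit hK hHP hJEP
      (RecursiveIn.trans_turingReducible hR hs) hs⟩
  · have he : ∀ i, IsEmpty (𝕂.struct i).dom := fun i =>
      ⟨fun x => hne ⟨i, x, x.2⟩⟩
    exact ⟨_, fun s hs => isFraisseLimitComputableIn_struct_of_isEmpty hK hHP hJEP he hs 0⟩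

end ComputableAge

theorem mainTheorem4 {L : FirstOrder.Language.{u, v}} (ρ : ComputableLanguage L)
    (K : Set (Bundled.{0} L.Structure)) (hK : IsAge K) (𝕂 : ComputableAge ρ K)
    (hHP : Hereditary K) (hJEP : JointEmbedding K) (hAP : Amalgamation K) :
    charFun 𝕂.embedInfo ≤ᵀ charFun haltingSet ∧
      ∃ M : NatStructure L,
        IsFraisseLimitComputableIn ρ K (charFun 𝕂.embedInfo) M ∧
        IsFraisseLimitComputableIn ρ K (charFun haltingSet) M := by
  have h := 𝕂.charFun_embedInfo_le_haltingSet
  obtain ⟨M, hM⟩ := 𝕂.exists_isFraisseLimitComputableIn hK hHP hJEP hAP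
  exact ⟨h, M, hM _ .rfl, hM _ h⟩
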